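/- Let $M$ be a complex manifold of dimension $3$ with a holomorphic Riemannian metric $g$ (a holomorphic field of non-degenerate complex symmetric bilinear forms on $TM$), let $x_0\in M$, and let $\mathcal G$ be the Lie algebra of germs at $x_0$ of holomorphic Killing fields of $g$ (fields $V$ with $L_Vg=0$) or, more generally, any Lie subalgebra of it. Assume that $\mathcal G$ is transitive (the evaluation $\mathcal G\to T_{x_0}M$ is onto; this is local homogeneity when $\mathcal G$ is the full Killing algebra), solvable, and of dimension $4$. Let $\mathcal I\subset\mathcal G$ be the isotropy algebra, i.e. the subalgebra of fields vanishing at $x_0$, let $G$ be the connected simply connected complex Lie group with Lie algebra $\mathcal G$, and let $I\subset G$ be the connected subgroup with Lie algebra $\mathcal I$. Let $\mathcal F$ be a holomorphic foliation of codimension one, defined near $x_0$, which is $\mathcal G$-invariant and whose leaves are $g$-degenerate, and let $\mathcal H\subset\mathcal G$ be the stabilizer of the leaf of $\mathcal F$ through $x_0$, i.e. the set of elements of $\mathcal G$ tangent to this leaf. Let $AG$ be the universal cover of the group of affine maps $w\mapsto aw+b$ of the complex line, and assume that $\mathcal H$ is isomorphic to the Lie algebra of $\mathbb C\times AG$. Then: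 (a) The isotropy is semisimple: $\mathcal I$ is spanned by an element $Y$ which acts on $T_{x_0}M$ (by $W(x_0)\mapsto[Y,W](x_0)$) as $\mathrm{diag}(0,1,-1)$ in some basis $(e_1,e_2,e_3)$ of $T_{x_0}M$ with $g(e_1,e_1)=g(e_2,e_3)=1$ and all other products $g(e_i,e_j)$, $i\le j$, equal to $0$. Moreover, there is an isomorphism from $\mathcal H$ to the Lie algebra of $\mathbb C\times AG$ that maps $\mathcal I$ onto the line spanned by the infinitesimal generator of the homotheties in $AG$. (b) The pair $(G,I)$ is isomorphic to one of the following: 1. $G=\mathbb C\times SOL$, where $SOL=\mathbb C\ltimes\mathbb C^2$ and $y\in\mathbb C$ acts on $\mathbb C^2$ by $\mathrm{diag}(e^{y},e^{-y})$; $I$ is the factor $\mathbb C$ of this semidirect product. 2. $G=\mathbb C\ltimes Heis$, where $Heis=\mathbb C^3$ is the complex Heisenberg group with the product $(x,z,t)(x',z',t')=(x+x'+tz',\,z+z',\,t+t')$ and $y\in\mathbb C$ acts on $Heis$ by $(x,z,t)\mapsto(x,e^{y}z,e^{-y}t)$; $I$ is the first factor $\mathbb C$. (In the basis $X',Z,T$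 of the Lie algebra of $Heis$ that belongs to the coordinates, $X'$ is central, $[T,Z]=X'$, and $y$ acts by $(X',Z,T)\mapsto(X',e^yZ,e^{-y}T)$.) 3. $G=\mathbb C^2\ltimes\mathbb C^2$, where $(y,x)$ in the first factor acts on the second one by $\begin{pmatrix}e^{y}&0\\0&e^{-y}\end{pmatrix}\begin{pmatrix}1&0\\0&e^{-x}\end{pmatrix}$; $I$ is the subgroup $\{(y,0)\}$ of the first factor. -/

import Mathlib

open Bundle Filter VectorField
open scoped Manifold Topology ContDiff

noncomputable section

namespace HolRiem

/-! ### Holomorphic vector fields and their Lie derivatives -/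

section Geometry

variable {E : Type*} [NormedAddCommGroup E] [NormedSpace ℂ E]
  {M : Type*} [TopologicalSpace M] [ChartedSpace E M]

/-- The derivative `V f` of a function along a vector field. -/
def lieDeriv (V : Π y : M, TangentSpace 𝓘(ℂ, E) y) (f : M → ℂ) (x : M) : ℂ :=
  mvfderiv 𝓘(ℂ, E) f x (V x)

theorem lieDeriv_congr {V : Π y : M, TangentSpace 𝓘(ℂ, E) y} {f f' : M → ℂ} {x : M}
    (h : f =ᶠ[𝓝 x] f') : lieDeriv V f x = lieDeriv V f' x := by
  have := h.mfderiv_eq (I := 𝓘(ℂ, E)) (I' := 𝓘(ℂ, ℂ))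
  exact congrArg (fun L : E →L[ℂ] ℂ ↦ L (V x)) this

variable [IsManifold 𝓘(ℂ, E) ω M]

/-- The vector field `V` is holomorphic near `x`. -/
def HolAt (V : Π y : M, TangentSpace 𝓘(ℂ, E) y) (x : M) : Prop :=
  ContMDiffAt 𝓘(ℂ, E) 𝓘(ℂ, E).tangent ω
    (fun y ↦ (TotalSpace.mk' E y (V y) : TangentBundle 𝓘(ℂ, E) M)) x

theorem HolAt.eventually {V : Π y : M, TangentSpace 𝓘(ℂ, E) y} {x : M} (hV : HolAt V x) :
    ∀ᶠ y in 𝓝 x, HolAt V y :=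
  (contMDiffAt_iff_contMDiffAt_nhds (by simp)).1 hV

theorem HolAt.mdiff {V : Π y : M, TangentSpace 𝓘(ℂ, E) y} {x : M} (hV : HolAt V x) :
    MDifferentiableAt 𝓘(ℂ, E) 𝓘(ℂ, E).tangent
      (fun y ↦ (TotalSpace.mk' E y (V y) : TangentBundle 𝓘(ℂ, E) M)) x :=
  ContMDiffAt.mdifferentiableAt hV (by simp)

theorem HolAt.lieBracket [CompleteSpace E] {V W : Π y : M, TangentSpace 𝓘(ℂ, E) y} {x : M}
    (hV : HolAt V x) (hW : HolAt W x) : HolAt (mlieBracket 𝓘(ℂ, E) V W) x := by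
  unfold HolAt at *
  rw [← contMDiffWithinAt_univ] at hV hW ⊢
  rw [← mlieBracketWithin_univ]
  exact ContMDiffWithinAt.mlieBracketWithin_vectorField (n := ω) hV hW uniqueMDiffOn_univ
    (Set.mem_univ _) (by simp)

theorem HolAt.lieDeriv {V : Π y : M, TangentSpace 𝓘(ℂ, E) y} {f : M → ℂ} {x : M}
    (hV : HolAt V x) (hf : ContMDiffAt 𝓘(ℂ, E) 𝓘(ℂ, ℂ) ω f x) :
    ContMDiffAt 𝓘(ℂ, E) 𝓘(ℂ, ℂ) ω (lieDeriv V f) x := by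
  have h1 := hf.mfderiv_const (m := ω) (by simp)
  have h2 := ContMDiffAt.clm_apply_of_inCoordinates h1 hV hf
  exact (contMDiff_snd_tangentBundle_modelSpace ℂ 𝓘(ℂ, ℂ)).contMDiffAt.comp x h2

theorem jac [CompleteSpace E] {U V W : Π y : M, TangentSpace 𝓘(ℂ, E) y} {x : M}
    (hU : HolAt U x) (hV : HolAt V x) (hW : HolAt W x) :
    mlieBracket 𝓘(ℂ, E) U (mlieBracket 𝓘(ℂ, E) V W) x =
      mlieBracket 𝓘(ℂ, E) (mlieBracket 𝓘(ℂ, E) U V) W x +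
        mlieBracket 𝓘(ℂ, E) V (mlieBracket 𝓘(ℂ, E) U W) x :=
  leibniz_identity_mlieBracket_apply (hU.of_le le_top) (hV.of_le le_top) (hW.of_le le_top)

theorem brk_fun [CompleteSpace E] {V U : Π y : M, TangentSpace 𝓘(ℂ, E) y} {f : M → ℂ} {x : M}
    (hU : HolAt U x) (hf : ContMDiffAt 𝓘(ℂ, E) 𝓘(ℂ, ℂ) ω f x) :
    mlieBracket 𝓘(ℂ, E) V (f • U) x =
      lieDeriv V f x • U x + f x • mlieBracket 𝓘(ℂ, E) V U x :=
  mlieBracket_smul_right (hf.mdifferentiableAt (by simp)) hU.mdiff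

theorem HolAt.smulFun {U : Π y : M, TangentSpace 𝓘(ℂ, E) y} {f : M → ℂ} {x : M}
    (hU : HolAt U x) (hf : ContMDiffAt 𝓘(ℂ, E) 𝓘(ℂ, ℂ) ω f x) : HolAt (f • U) x :=
  ContMDiffAt.smul_section hf hU

theorem lieDeriv_aux [CompleteSpace E] {U V W : Π y : M, TangentSpace 𝓘(ℂ, E) y} {f : M → ℂ}
    {x : M} (hU : HolAt U x) (hV : HolAt V x) (hW : HolAt W x)
    (hf : ContMDiffAt 𝓘(ℂ, E) 𝓘(ℂ, ℂ) ω f x) :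
    lieDeriv (mlieBracket 𝓘(ℂ, E) V W) f x • U x =
      (lieDeriv V (lieDeriv W f) x - lieDeriv W (lieDeriv V f) x) • U x := by
  have hfe := (contMDiffAt_iff_contMDiffAt_nhds (by simp)).1 hf
  have key : ∀ A : Π y : M, TangentSpace 𝓘(ℂ, E) y,
      mlieBracket 𝓘(ℂ, E) A (f • U) =ᶠ[𝓝 x]
        lieDeriv A f • U + f • mlieBracket 𝓘(ℂ, E) A U := by
    intro A
    filter_upwards [hU.eventually, hfe] with y h1 h2
    exact brk_fun h1 h2
  have expand : ∀ A B : Π y : M, TangentSpace 𝓘(ℂ, E) y, HolAt A x → HolAt B x →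
      mlieBracket 𝓘(ℂ, E) A (mlieBracket 𝓘(ℂ, E) B (f • U)) x =
        lieDeriv A (lieDeriv B f) x • U x + lieDeriv B f x • mlieBracket 𝓘(ℂ, E) A U x +
        (lieDeriv A f x • mlieBracket 𝓘(ℂ, E) B U x +
          f x • mlieBracket 𝓘(ℂ, E) A (mlieBracket 𝓘(ℂ, E) B U) x) := by
    intro A B hA hB
    rw [(EventuallyEq.refl _ A).mlieBracket_vectorField_eq (key B),
      mlieBracket_add_right (hU.smulFun (hB.lieDeriv hf)).mdiff
        ((hB.lieBracket hU).smulFun hf).mdiff, brk_fun hU (hB.lieDeriv hf),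
        brk_fun (hB.lieBracket hU) hf]
  have h := jac hV hW (hU.smulFun hf)
  rw [expand V W hV hW, expand W V hW hV, brk_fun hU hf, jac hV hW hU] at h
  rw [sub_smul, eq_sub_iff_add_eq]
  rw [smul_add] at h
  have h3 := sub_eq_zero.2 h
  rw [← sub_eq_zero, ← neg_eq_zero, ← h3]
  abel

theorem lieDeriv_lieBracket [CompleteSpace E] {V W : Π y : M, TangentSpace 𝓘(ℂ, E) y} {f : M → ℂ}
    {x : M} (hV : HolAt V x) (hW : HolAt W x) (hf : ContMDiffAt 𝓘(ℂ, E) 𝓘(ℂ, ℂ) ω f x) :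
    lieDeriv (mlieBracket 𝓘(ℂ, E) V W) f x =
      lieDeriv V (lieDeriv W f) x - lieDeriv W (lieDeriv V f) x := by
  by_cases h1 : V x = 0
  · by_cases h2 : W x = 0
    · have : mlieBracket 𝓘(ℂ, E) V W x = 0 := by
        rw [← mlieBracketWithin_univ]
        exact mlieBracketWithin_eq_zero_of_eq_zero h1 h2
      simp [lieDeriv, this, h1, h2]
    · exact smul_left_injective ℂ h2 (lieDeriv_aux hW hV hW hf)
  · exact smul_left_injective ℂ h1 (lieDeriv_aux hV hV hW hf)


/-- Vector fields on `M` that are holomorphic near `x₀`. -/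
def holFields (E : Type*) [NormedAddCommGroup E] [NormedSpace ℂ E]
    {M : Type*} [TopologicalSpace M] [ChartedSpace E M] [IsManifold 𝓘(ℂ, E) ω M] (x₀ : M) :
    Submodule ℂ (Π y : M, TangentSpace 𝓘(ℂ, E) y) where
  carrier := {V | HolAt V x₀}
  add_mem' h1 h2 := ContMDiffAt.add_section h1 h2
  zero_mem' := contMDiffAt_zeroSection ℂ (TangentSpace 𝓘(ℂ, E))
  smul_mem' c _ hV := HolAt.smulFun (f := fun _ ↦ c) hV contMDiffAt_const

/-- The fields vanishing identically near `x₀`. -/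
def zeroFields (E : Type*) [NormedAddCommGroup E] [NormedSpace ℂ E]
    {M : Type*} [TopologicalSpace M] [ChartedSpace E M] [IsManifold 𝓘(ℂ, E) ω M] (x₀ : M) :
    Submodule ℂ (holFields E x₀) where
  carrier := {V | ∀ᶠ y in 𝓝 x₀, V.1 y = 0}
  add_mem' h1 h2 := by
    filter_upwards [h1, h2] with y a b
    exact (congrArg₂ (· + ·) a b).trans (add_zero _)
  zero_mem' := Eventually.of_forall fun _ ↦ rfl
  smul_mem' c V hV := by
    filter_upwards [hV] with y a
    exact (congrArg (c • ·) a).trans (smul_zero _)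

/-- Germs at `x₀` of holomorphic vector fields. -/
def HolGerm (E : Type*) [NormedAddCommGroup E] [NormedSpace ℂ E]
    {M : Type*} [TopologicalSpace M] [ChartedSpace E M] [IsManifold 𝓘(ℂ, E) ω M] (x₀ : M) : Type _ :=
  holFields E x₀ ⧸ zeroFields E x₀

variable {x₀ : M}

instance : AddCommGroup (HolGerm E x₀) :=
  inferInstanceAs (AddCommGroup (holFields E x₀ ⧸ zeroFields E x₀))

instance : Module ℂ (HolGerm E x₀) :=
  inferInstanceAs (Module ℂ (holFields E x₀ ⧸ zeroFields E x₀))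

/-- The germ of a holomorphic vector field. -/
def germ (x₀ : M) : holFields E x₀ →ₗ[ℂ] HolGerm E x₀ := (zeroFields E x₀).mkQ

theorem germ_surjective : Function.Surjective (germ (E := E) x₀) :=
  (zeroFields E x₀).mkQ_surjective

theorem germ_eq_iff {V W : holFields E x₀} :
    germ x₀ V = germ x₀ W ↔ ∀ᶠ y in 𝓝 x₀, V.1 y = W.1 y := by
  refine (Submodule.Quotient.eq (zeroFields E x₀)).trans ?_
  refine eventually_congr (Eventually.of_forall fun y ↦ ?_)
  exact sub_eq_zero

/-- The value at `x₀` of a germ of vector field. -/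
def ev (x₀ : M) : HolGerm E x₀ →ₗ[ℂ] TangentSpace 𝓘(ℂ, E) x₀ :=
  (zeroFields E x₀).liftQ
    { toFun := fun V ↦ V.1 x₀
      map_add' := fun _ _ ↦ rfl
      map_smul' := fun _ _ ↦ rfl }
    (fun _ hV ↦ hV.self_of_nhds)

theorem ev_germ (V : holFields E x₀) : ev x₀ (germ x₀ V) = V.1 x₀ := rfl

theorem HolAt.of_mem {V : holFields E x₀} : ∀ᶠ y in 𝓝 x₀, HolAt V.1 y := HolAt.eventually V.2

/-- A holomorphic Riemannian metric on the complex manifold `M`: a holomorphic field of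
non-degenerate complex symmetric bilinear forms on the holomorphic tangent bundle. -/
structure HolRiemannianMetric (E : Type*) [NormedAddCommGroup E] [NormedSpace ℂ E]
    (M : Type*) [TopologicalSpace M] [ChartedSpace E M] [IsManifold 𝓘(ℂ, E) ω M] where
  /-- the bilinear form on the tangent space at `x` -/
  form (x : M) : TangentSpace 𝓘(ℂ, E) x →L[ℂ] TangentSpace 𝓘(ℂ, E) x →L[ℂ] ℂ
  symm (x : M) (v w : TangentSpace 𝓘(ℂ, E) x) : form x v w = form x w v
  nondegenerate (x : M) (v : TangentSpace 𝓘(ℂ, E) x) (hv : ∀ w, form x v w = 0) : v = 0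
  holomorphic : ContMDiff 𝓘(ℂ, E) (𝓘(ℂ, E).prod 𝓘(ℂ, E →L[ℂ] E →L[ℂ] ℂ)) ω
    (fun x ↦ TotalSpace.mk' (E →L[ℂ] E →L[ℂ] ℂ)
      (E := fun x : M ↦ (TangentSpace 𝓘(ℂ, E) x →L[ℂ] TangentSpace 𝓘(ℂ, E) x →L[ℂ] ℂ)) x (form x))

/-- The function `g(A, B)`. -/
def HolRiemannianMetric.apply (g : HolRiemannianMetric E M) (A B : Π y : M, TangentSpace 𝓘(ℂ, E) y)
    (y : M) : ℂ :=
  g.form y (A y) (B y)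

theorem HolRiemannianMetric.hol (g : HolRiemannianMetric E M)
    {A B : Π y : M, TangentSpace 𝓘(ℂ, E) y} {x : M} (hA : HolAt A x) (hB : HolAt B x) :
    ContMDiffAt 𝓘(ℂ, E) 𝓘(ℂ, ℂ) ω (g.apply A B) x := by
  have h : ContMDiffAt 𝓘(ℂ, E) (𝓘(ℂ, E).prod 𝓘(ℂ, ℂ)) ω
      (fun m ↦ TotalSpace.mk' ℂ (E := Bundle.Trivial M ℂ) m (g.form m (A m) (B m))) x :=
    ContMDiffAt.clm_bundle_apply₂ (F₁ := E) (F₂ := E) (F₃ := ℂ) (E₃ := Bundle.Trivial M ℂ)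
      g.holomorphic.contMDiffAt hA hB
  rw [contMDiffAt_totalSpace] at h
  exact h.2

variable [CompleteSpace E]

/-- The Lie bracket of holomorphic vector fields. -/
def holBracket (V W : holFields E x₀) : holFields E x₀ :=
  ⟨mlieBracket 𝓘(ℂ, E) V.1 W.1, HolAt.lieBracket V.2 W.2⟩

instance : Bracket (HolGerm E x₀) (HolGerm E x₀) where
  bracket v w := Quotient.liftOn₂' v w (fun V W ↦ germ x₀ (holBracket V W)) (by
    intro V W V' W' hV hW
    have h1 := germ_eq_iff.1 ((Submodule.Quotient.eq _).2 ((Submodule.quotientRel_def _).1 hV))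
    have h2 := germ_eq_iff.1 ((Submodule.Quotient.eq _).2 ((Submodule.quotientRel_def _).1 hW))
    exact germ_eq_iff.2 (EventuallyEq.mlieBracket_vectorField h1 h2))

theorem germ_lie (V W : holFields E x₀) :
    ⁅germ x₀ V, germ x₀ W⁆ = germ x₀ (holBracket V W) := rfl

instance : LieRing (HolGerm E x₀) where
  add_lie u v w := by
    obtain ⟨u, rfl⟩ := germ_surjective u
    obtain ⟨v, rfl⟩ := germ_surjective v
    obtain ⟨w, rfl⟩ := germ_surjective w
    rw [← map_add, germ_lie, germ_lie, germ_lie, ← map_add, germ_eq_iff]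
    filter_upwards [HolAt.of_mem (V := u), HolAt.of_mem (V := v)] with y hu hv
    exact mlieBracket_add_left hu.mdiff hv.mdiff
  lie_add u v w := by
    obtain ⟨u, rfl⟩ := germ_surjective u
    obtain ⟨v, rfl⟩ := germ_surjective v
    obtain ⟨w, rfl⟩ := germ_surjective w
    rw [← map_add, germ_lie, germ_lie, germ_lie, ← map_add, germ_eq_iff]
    filter_upwards [HolAt.of_mem (V := v), HolAt.of_mem (V := w)] with y hv hw
    exact mlieBracket_add_right hv.mdiff hw.mdiff
  lie_self u := by
    obtain ⟨u, rfl⟩ := germ_surjective u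
    rw [germ_lie, ← map_zero (germ (E := E) x₀), germ_eq_iff]
    exact Eventually.of_forall fun y ↦ congrFun mlieBracket_self y
  leibniz_lie u v w := by
    obtain ⟨u, rfl⟩ := germ_surjective u
    obtain ⟨v, rfl⟩ := germ_surjective v
    obtain ⟨w, rfl⟩ := germ_surjective w
    simp only [germ_lie]
    rw [← map_add, germ_eq_iff]
    filter_upwards [HolAt.of_mem (V := u), HolAt.of_mem (V := v), HolAt.of_mem (V := w)]
      with y hu hv hw
    exact jac hu hv hw

instance : LieAlgebra ℂ (HolGerm E x₀) where
  lie_smul c v w := by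
    obtain ⟨v, rfl⟩ := germ_surjective v
    obtain ⟨w, rfl⟩ := germ_surjective w
    rw [← map_smul, germ_lie, germ_lie, ← map_smul, germ_eq_iff]
    filter_upwards [HolAt.of_mem (V := w)] with y hw
    exact mlieBracket_const_smul_right hw.mdiff

/-- `V` is a Killing field of `g` near `x₀`: the Lie derivative `L_V g` vanishes near `x₀`, i.e.
`V (g(A, B)) = g([V, A], B) + g(A, [V, B])` for all holomorphic vector fields `A`, `B`. -/
def IsKilling (g : HolRiemannianMetric E M) (x₀ : M) (V : Π y : M, TangentSpace 𝓘(ℂ, E) y) : Prop :=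
  ∀ A B : Π y : M, TangentSpace 𝓘(ℂ, E) y, HolAt A x₀ → HolAt B x₀ →
    ∀ᶠ y in 𝓝 x₀, lieDeriv V (g.apply A B) y =
      g.apply (mlieBracket 𝓘(ℂ, E) V A) B y + g.apply A (mlieBracket 𝓘(ℂ, E) V B) y

theorem IsKilling.lieDeriv_lieDeriv {g : HolRiemannianMetric E M}
    {V W : Π y : M, TangentSpace 𝓘(ℂ, E) y} (hV : IsKilling g x₀ V) (hW : IsKilling g x₀ W)
    (hW' : HolAt W x₀)
    {A B : Π y : M, TangentSpace 𝓘(ℂ, E) y} (hA : HolAt A x₀) (hB : HolAt B x₀) :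
    ∀ᶠ y in 𝓝 x₀, lieDeriv V (lieDeriv W (g.apply A B)) y =
      (g.apply (mlieBracket 𝓘(ℂ, E) V (mlieBracket 𝓘(ℂ, E) W A)) B y +
        g.apply (mlieBracket 𝓘(ℂ, E) W A) (mlieBracket 𝓘(ℂ, E) V B) y) +
      (g.apply (mlieBracket 𝓘(ℂ, E) V A) (mlieBracket 𝓘(ℂ, E) W B) y +
        g.apply A (mlieBracket 𝓘(ℂ, E) V (mlieBracket 𝓘(ℂ, E) W B)) y) := by
  filter_upwards [(hW A B hA hB).eventually_nhds, hV _ _ (hW'.lieBracket hA) hB,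
    hV _ _ hA (hW'.lieBracket hB), hA.eventually, hB.eventually, hW'.eventually]
    with y h1 h2 h3 hA hB hW
  rw [lieDeriv_congr h1, ← h2, ← h3]
  have ha := (g.hol (hW.lieBracket hA) hB).mdifferentiableAt (by simp)
  have hb := (g.hol hA (hW.lieBracket hB)).mdifferentiableAt (by simp)
  exact congrArg (fun L ↦ L (V y)) (mvfderiv_add ha hb)

theorem IsKilling.lieBracket {g : HolRiemannianMetric E M}
    {V W : Π y : M, TangentSpace 𝓘(ℂ, E) y} (hV : IsKilling g x₀ V) (hW : IsKilling g x₀ W)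
    (hV' : HolAt V x₀) (hW' : HolAt W x₀) :
    IsKilling g x₀ (mlieBracket 𝓘(ℂ, E) V W) := by
  intro A B hA hB
  filter_upwards [hV.lieDeriv_lieDeriv hW hW' hA hB, hW.lieDeriv_lieDeriv hV hV' hA hB,
    hA.eventually, hB.eventually, hV'.eventually, hW'.eventually] with y h1 h2 hA hB hV hW
  rw [lieDeriv_lieBracket hV hW (g.hol hA hB), h1, h2]
  have e1 := jac hV hW hA
  have e2 := jac hV hW hB
  simp only [HolRiemannianMetric.apply] at *
  rw [e1, e2, map_add, map_add, add_apply]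
  ring

/-- The Killing algebra of `g` at `x₀`: germs at `x₀` of holomorphic Killing fields. -/
def killingAlgebra (g : HolRiemannianMetric E M) (x₀ : M) : LieSubalgebra ℂ (HolGerm E x₀) where
  carrier := {v | ∃ V : holFields E x₀, germ x₀ V = v ∧ IsKilling g x₀ V.1}
  add_mem' := by
    rintro _ _ ⟨V, rfl, hV⟩ ⟨W, rfl, hW⟩
    refine ⟨V + W, map_add _ _ _, fun A B hA hB ↦ ?_⟩
    filter_upwards [hV A B hA hB, hW A B hA hB, HolAt.of_mem (V := V), HolAt.of_mem (V := W)]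
      with y h1 h2 h3 h4
    have e1 : mlieBracket 𝓘(ℂ, E) (V + W : holFields E x₀).1 A y = _ :=
      mlieBracket_add_left (W := A) h3.mdiff h4.mdiff
    have e2 : mlieBracket 𝓘(ℂ, E) (V + W : holFields E x₀).1 B y = _ :=
      mlieBracket_add_left (W := B) h3.mdiff h4.mdiff
    have e3 : lieDeriv (V + W : holFields E x₀).1 (g.apply A B) y =
        lieDeriv V.1 (g.apply A B) y + lieDeriv W.1 (g.apply A B) y := map_add _ _ _
    rw [e3, h1, h2]
    simp only [HolRiemannianMetric.apply]
    rw [e1, e2, map_add, map_add, add_apply]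
    ring
  zero_mem' := by
    refine ⟨0, map_zero _, fun A B _ _ ↦ Eventually.of_forall fun y ↦ ?_⟩
    have e1 : mlieBracket 𝓘(ℂ, E) (0 : holFields E x₀).1 A y = 0 :=
      congrFun mlieBracket_zero_left y
    have e2 : mlieBracket 𝓘(ℂ, E) (0 : holFields E x₀).1 B y = 0 :=
      congrFun mlieBracket_zero_left y
    have e3 : lieDeriv (0 : holFields E x₀).1 (g.apply A B) y = 0 := map_zero _
    rw [e3]
    simp only [HolRiemannianMetric.apply]
    rw [e1, e2, map_zero, map_zero, zero_apply, add_zero]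
  smul_mem' := by
    rintro c _ ⟨V, rfl, hV⟩
    refine ⟨c • V, map_smul _ _ _, fun A B hA hB ↦ ?_⟩
    filter_upwards [hV A B hA hB, HolAt.of_mem (V := V)] with y h1 h3
    have e1 : mlieBracket 𝓘(ℂ, E) (c • V : holFields E x₀).1 A y = _ :=
      mlieBracket_const_smul_left (W := A) h3.mdiff
    have e2 : mlieBracket 𝓘(ℂ, E) (c • V : holFields E x₀).1 B y = _ :=
      mlieBracket_const_smul_left (W := B) h3.mdiff
    have e3 : lieDeriv (c • V : holFields E x₀).1 (g.apply A B) y =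
        c • lieDeriv V.1 (g.apply A B) y := map_smul _ _ _
    rw [e3, h1]
    simp only [HolRiemannianMetric.apply]
    rw [e1, e2, map_smul, map_smul, smul_apply, smul_add]
  lie_mem' := by
    rintro _ _ ⟨V, rfl, hV⟩ ⟨W, rfl, hW⟩
    exact ⟨holBracket V W, rfl, hV.lieBracket hW V.2 W.2⟩


/-- The Lie algebra `𝒢` of vector fields is transitive (at `x₀`): its elements take all values
at `x₀`. -/
def IsTransitive (𝒢 : LieSubalgebra ℂ (HolGerm E x₀)) : Prop :=
  ∀ w : TangentSpace 𝓘(ℂ, E) x₀, ∃ v ∈ 𝒢, ev x₀ v = w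

/-- The isotropy algebra at `x₀`: the elements of `𝒢` that vanish at `x₀`. -/
def isotropy (𝒢 : LieSubalgebra ℂ (HolGerm E x₀)) : Submodule ℂ (HolGerm E x₀) :=
  𝒢.toSubmodule ⊓ LinearMap.ker (ev x₀)

/-- `A` is the infinitesimal action on `T_{x₀} M` of the vector field `v` vanishing at `x₀`. -/
def IsIsotropyAction (v : HolGerm E x₀)
    (A : TangentSpace 𝓘(ℂ, E) x₀ →ₗ[ℂ] TangentSpace 𝓘(ℂ, E) x₀) : Prop :=
  ∀ w : HolGerm E x₀, ev x₀ ⁅v, w⁆ = A (ev x₀ w)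

/-- The isotropy is a semi-simple one-parameter group: it has a generator `Y` which acts by
`diag(0, 1, -1)`, i.e. whose flow acts by `diag(1, e^s, e^{-s})`, in a basis `(e 0, e 1, e 2)` of
`T_{x₀} M` where `e 0` has norm `1`, where `e 1` and `e 2` span the two isotropic lines of the
plane orthogonal to `e 0`, and where `g (e 1, e 2) = 1`. -/
def IsSemisimpleIsotropy (g : HolRiemannianMetric E M) (𝒢 : LieSubalgebra ℂ (HolGerm E x₀)) :
    Prop :=
  ∃ (Y : HolGerm E x₀) (A : TangentSpace 𝓘(ℂ, E) x₀ →ₗ[ℂ] TangentSpace 𝓘(ℂ, E) x₀)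
    (e : Module.Basis (Fin 3) ℂ (TangentSpace 𝓘(ℂ, E) x₀)),
    isotropy 𝒢 = Submodule.span ℂ {Y} ∧ IsIsotropyAction Y A ∧
    A (e 0) = 0 ∧ A (e 1) = e 1 ∧ A (e 2) = -e 2 ∧
    g.form x₀ (e 0) (e 0) = 1 ∧ g.form x₀ (e 0) (e 1) = 0 ∧ g.form x₀ (e 0) (e 2) = 0 ∧
    g.form x₀ (e 1) (e 1) = 0 ∧ g.form x₀ (e 2) (e 2) = 0 ∧ g.form x₀ (e 1) (e 2) = 1

/-- The level sets of `f` are the leaves of a holomorphic foliation of codimension one of a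
neighbourhood of `x₀` which is `g`-degenerate (`g` restricts to a degenerate form on each tangent
plane of a leaf) and `𝒢`-invariant (for `V` in `𝒢`, the function `V f` is locally constant on the
leaves, so that the flow of `V` permutes the leaves). -/
structure DefinesFoliation (g : HolRiemannianMetric E M) (𝒢 : LieSubalgebra ℂ (HolGerm E x₀))
    (f : M → ℂ) : Prop where
  holomorphic : ContMDiffAt 𝓘(ℂ, E) 𝓘(ℂ, ℂ) ω f x₀
  submersion : mvfderiv 𝓘(ℂ, E) f x₀ ≠ 0
  degenerate : ∀ᶠ y in 𝓝 x₀, ∃ v : TangentSpace 𝓘(ℂ, E) y, v ≠ 0 ∧ mvfderiv 𝓘(ℂ, E) f y v = 0 ∧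
    ∀ w : TangentSpace 𝓘(ℂ, E) y, mvfderiv 𝓘(ℂ, E) f y w = 0 → g.form y v w = 0
  invariant : ∀ V : holFields E x₀, germ x₀ V ∈ 𝒢 → ∀ᶠ y in 𝓝 x₀,
    ∀ w : TangentSpace 𝓘(ℂ, E) y, mvfderiv 𝓘(ℂ, E) f y w = 0 →
      mvfderiv 𝓘(ℂ, E) (lieDeriv V.1 f) y w = 0

/-- The stabilizer of the leaf `{f = f x₀}` through `x₀`: the elements of `𝒢` which are tangent to
this leaf at each of its points near `x₀`. -/
def leafStabilizer (𝒢 : LieSubalgebra ℂ (HolGerm E x₀)) (f : M → ℂ) :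
    Submodule ℂ (HolGerm E x₀) where
  carrier := {v | v ∈ 𝒢 ∧ ∃ V : holFields E x₀, germ x₀ V = v ∧
    ∀ᶠ y in 𝓝 x₀, f y = f x₀ → lieDeriv V.1 f y = 0}
  add_mem' := by
    rintro _ _ ⟨hv, V, rfl, hV⟩ ⟨hw, W, rfl, hW⟩
    refine ⟨add_mem hv hw, V + W, map_add _ _ _, ?_⟩
    filter_upwards [hV, hW] with y h1 h2 h
    have e3 : lieDeriv (V + W : holFields E x₀).1 f y =
        lieDeriv V.1 f y + lieDeriv W.1 f y := map_add _ _ _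
    rw [e3, h1 h, h2 h, add_zero]
  zero_mem' := ⟨zero_mem _, 0, map_zero _, Eventually.of_forall fun _ _ ↦ map_zero _⟩
  smul_mem' := by
    rintro c _ ⟨hv, V, rfl, hV⟩
    refine ⟨𝒢.smul_mem c hv, c • V, map_smul _ _ _, ?_⟩
    filter_upwards [hV] with y h1 h
    have e3 : lieDeriv (c • V : holFields E x₀).1 f y = c • lieDeriv V.1 f y := map_smul _ _ _
    rw [e3, h1 h, smul_zero]

end Geometry

/-! ### Simply connected complex Lie groups and their Lie algebras -/

section Groups

/-- The velocity at the identity of a one-parameter subgroup: the generator of its Lie algebra. -/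
def velocity (F : Type*) [NormedAddCommGroup F] [NormedSpace ℂ F]
    {G : Type*} [TopologicalSpace G] [ChartedSpace F G] [Group G]
    (γ : Multiplicative ℂ →* G) : GroupLieAlgebra 𝓘(ℂ, F) G :=
  (mfderiv 𝓘(ℂ, ℂ) 𝓘(ℂ, F) (fun s : ℂ ↦ γ (Multiplicative.ofAdd s)) 0 (1 : ℂ) : F)

/-- `G` is the connected simply connected complex Lie group whose Lie algebra is the Lie subalgebra
`S` of `L`, the identification being `φ`. -/
def IsGroupOf (F : Type*) [NormedAddCommGroup F] [NormedSpace ℂ F] [CompleteSpace F]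
    {G : Type*} [TopologicalSpace G] [ChartedSpace F G] [Group G] [LieGroup 𝓘(ℂ, F) ω G]
    {L : Type*} [LieRing L] [LieAlgebra ℂ L]
    (φ : GroupLieAlgebra 𝓘(ℂ, F) G →ₗ⁅ℂ⁆ L) (S : Submodule ℂ L) : Prop :=
  SimplyConnectedSpace G ∧ Function.Injective φ ∧
    LinearMap.range (φ : GroupLieAlgebra 𝓘(ℂ, F) G →ₗ[ℂ] L) = S

/-- `G` is the connected simply connected complex Lie group whose Lie algebra is `S`, and the image
of `γ` is its one-parameter subgroup whose Lie algebra is `J`. -/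
def IsPairOf (F : Type*) [NormedAddCommGroup F] [NormedSpace ℂ F] [CompleteSpace F]
    {G : Type*} [TopologicalSpace G] [ChartedSpace F G] [Group G] [LieGroup 𝓘(ℂ, F) ω G]
    {L : Type*} [LieRing L] [LieAlgebra ℂ L]
    (γ : Multiplicative ℂ →* G) (S J : Submodule ℂ L) : Prop :=
  ∃ φ : GroupLieAlgebra 𝓘(ℂ, F) G →ₗ⁅ℂ⁆ L,
    IsGroupOf F φ S ∧ J = Submodule.span ℂ {φ (velocity F γ)}

theorem contMDiff_prod_self {F : Type*} [NormedAddCommGroup F] [NormedSpace ℂ F]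
    {m : F × F → F} (h : ContDiff ℂ ω m) :
    ContMDiff (𝓘(ℂ, F).prod 𝓘(ℂ, F)) 𝓘(ℂ, F) ω m := by
  rw [← modelWithCornersSelf_prod, chartedSpaceSelf_prod]
  exact h.contMDiff

/-- `ℂ × AG`, where `AG` is the universal cover of the group of affine maps `w ↦ e^y w + z` of the
complex line; the coordinates of a point are `(y, x, z)`, with `x` in the factor `ℂ` and `(y, z)`
in `AG`. -/
def CAG : Type := EuclideanSpace ℂ (Fin 3)

namespace CAG

/-- The group law of `CAG`. -/
protected def mul (p q : EuclideanSpace ℂ (Fin 3)) : EuclideanSpace ℂ (Fin 3) :=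
  !₂[p 0 + q 0, p 1 + q 1, p 2 + Complex.exp (p 0) * q 2]

/-- The inverse in `CAG`. -/
protected def inv (p : EuclideanSpace ℂ (Fin 3)) : EuclideanSpace ℂ (Fin 3) :=
  !₂[-p 0, -p 1, -(Complex.exp (-p 0) * p 2)]

instance : Group CAG where
  mul := CAG.mul
  one := (0 : EuclideanSpace ℂ (Fin 3))
  inv := CAG.inv
  mul_assoc p q r := by
    change CAG.mul (CAG.mul p q) r = CAG.mul p (CAG.mul q r)
    ext i
    fin_cases i <;> simp [CAG.mul, Complex.exp_add] <;> field_simp <;> ring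
  one_mul p := by
    change CAG.mul 0 p = p
    ext i
    fin_cases i <;> simp [CAG.mul]
  mul_one p := by
    change CAG.mul p 0 = p
    ext i
    fin_cases i <;> simp [CAG.mul]
  inv_mul_cancel p := by
    change CAG.mul (CAG.inv p) p = 0
    ext i
    fin_cases i <;> simp [CAG.mul, CAG.inv, Complex.exp_neg]

instance : TopologicalSpace CAG := inferInstanceAs (TopologicalSpace (EuclideanSpace ℂ (Fin 3)))

instance : ChartedSpace (EuclideanSpace ℂ (Fin 3)) CAG := chartedSpaceSelf (EuclideanSpace ℂ (Fin 3))

instance : SimplyConnectedSpace CAG := inferInstanceAs (SimplyConnectedSpace (EuclideanSpace ℂ (Fin 3)))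

instance : LieGroup 𝓘(ℂ, EuclideanSpace ℂ (Fin 3)) ω CAG where
  toIsManifold := inferInstanceAs (IsManifold 𝓘(ℂ, EuclideanSpace ℂ (Fin 3)) ω (EuclideanSpace ℂ (Fin 3)))
  contMDiff_mul := contMDiff_prod_self (m := fun p ↦ CAG.mul p.1 p.2)
    (contDiff_euclidean.2 fun i ↦ by fin_cases i <;> simp [CAG.mul] <;> fun_prop)
  contMDiff_inv := ContDiff.contMDiff (f := CAG.inv)
    (contDiff_euclidean.2 fun i ↦ by fin_cases i <;> simp [CAG.inv] <;> fun_prop)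

/-- The one-parameter subgroup `y ↦ (y, 0, 0)`. -/
def oneParam : Multiplicative ℂ →* CAG where
  toFun y := (!₂[y.toAdd, 0, 0] : EuclideanSpace ℂ (Fin 3))
  map_one' := by
    change (_ : EuclideanSpace ℂ (Fin 3)) = 0
    ext i
    fin_cases i <;> simp
  map_mul' a b := by
    change _ = CAG.mul _ _
    ext i
    fin_cases i <;> simp [CAG.mul]

end CAG

/-- `ℂ × SOL`, `SOL = ℂ ⋉ ℂ²`, where `y ∈ ℂ` acts on `ℂ²` by `diag(e^y, e^{-y})`; the coordinates
of a point are `(y, x, z, t)`, with `x` in the factor `ℂ` and `(y, (z, t))` in `SOL`. -/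
def CSol : Type := EuclideanSpace ℂ (Fin 4)

namespace CSol

/-- The group law of `CSol`. -/
protected def mul (p q : EuclideanSpace ℂ (Fin 4)) : EuclideanSpace ℂ (Fin 4) :=
  !₂[p 0 + q 0, p 1 + q 1, p 2 + Complex.exp (p 0) * q 2, p 3 + Complex.exp (-p 0) * q 3]

/-- The inverse in `CSol`. -/
protected def inv (p : EuclideanSpace ℂ (Fin 4)) : EuclideanSpace ℂ (Fin 4) :=
  !₂[-p 0, -p 1, -(Complex.exp (-p 0) * p 2), -(Complex.exp (p 0) * p 3)]

instance : Group CSol where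
  mul := CSol.mul
  one := (0 : EuclideanSpace ℂ (Fin 4))
  inv := CSol.inv
  mul_assoc p q r := by
    change CSol.mul (CSol.mul p q) r = CSol.mul p (CSol.mul q r)
    ext i
    fin_cases i <;> simp [CSol.mul, Complex.exp_add, Complex.exp_neg] <;> field_simp <;> ring
  one_mul p := by
    change CSol.mul 0 p = p
    ext i
    fin_cases i <;> simp [CSol.mul]
  mul_one p := by
    change CSol.mul p 0 = p
    ext i
    fin_cases i <;> simp [CSol.mul]
  inv_mul_cancel p := by
    change CSol.mul (CSol.inv p) p = 0
    ext i
    fin_cases i <;> simp [CSol.mul, CSol.inv, Complex.exp_neg]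

instance : TopologicalSpace CSol := inferInstanceAs (TopologicalSpace (EuclideanSpace ℂ (Fin 4)))

instance : ChartedSpace (EuclideanSpace ℂ (Fin 4)) CSol := chartedSpaceSelf (EuclideanSpace ℂ (Fin 4))

instance : SimplyConnectedSpace CSol := inferInstanceAs (SimplyConnectedSpace (EuclideanSpace ℂ (Fin 4)))

instance : LieGroup 𝓘(ℂ, EuclideanSpace ℂ (Fin 4)) ω CSol where
  toIsManifold := inferInstanceAs (IsManifold 𝓘(ℂ, EuclideanSpace ℂ (Fin 4)) ω (EuclideanSpace ℂ (Fin 4)))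
  contMDiff_mul := contMDiff_prod_self (m := fun p ↦ CSol.mul p.1 p.2)
    (contDiff_euclidean.2 fun i ↦ by fin_cases i <;> simp [CSol.mul] <;> fun_prop)
  contMDiff_inv := ContDiff.contMDiff (f := CSol.inv)
    (contDiff_euclidean.2 fun i ↦ by fin_cases i <;> simp [CSol.inv] <;> fun_prop)

/-- The one-parameter subgroup `y ↦ (y, 0, 0, 0)`. -/
def oneParam : Multiplicative ℂ →* CSol where
  toFun y := (!₂[y.toAdd, 0, 0, 0] : EuclideanSpace ℂ (Fin 4))
  map_one' := by
    change (_ : EuclideanSpace ℂ (Fin 4)) = 0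
    ext i
    fin_cases i <;> simp
  map_mul' a b := by
    change _ = CSol.mul _ _
    ext i
    fin_cases i <;> simp [CSol.mul]

end CSol

/-- `ℂ ⋉ Heis`; the coordinates of a point are `(y, x, z, t)`, with `y` in `ℂ` and `(x, z, t)` in
the Heisenberg group, whose law is `(x, z, t) (x', z', t') = (x + x' + t z', z + z', t + t')`, and
`y` acts on `Heis` by `(x, z, t) ↦ (x, e^y z, e^{-y} t)`. -/
def CHeis : Type := EuclideanSpace ℂ (Fin 4)

namespace CHeis

/-- The group law of `CHeis`. -/
protected def mul (p q : EuclideanSpace ℂ (Fin 4)) : EuclideanSpace ℂ (Fin 4) :=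
  !₂[p 0 + q 0, p 1 + q 1 + p 3 * (Complex.exp (p 0) * q 2), p 2 + Complex.exp (p 0) * q 2, p 3 + Complex.exp (-p 0) * q 3]

/-- The inverse in `CHeis`. -/
protected def inv (p : EuclideanSpace ℂ (Fin 4)) : EuclideanSpace ℂ (Fin 4) :=
  !₂[-p 0, -p 1 + p 3 * p 2, -(Complex.exp (-p 0) * p 2), -(Complex.exp (p 0) * p 3)]

instance : Group CHeis where
  mul := CHeis.mul
  one := (0 : EuclideanSpace ℂ (Fin 4))
  inv := CHeis.inv
  mul_assoc p q r := by
    change CHeis.mul (CHeis.mul p q) r = CHeis.mul p (CHeis.mul q r)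
    ext i
    fin_cases i <;> simp [CHeis.mul, Complex.exp_add, Complex.exp_neg] <;> field_simp <;> ring
  one_mul p := by
    change CHeis.mul 0 p = p
    ext i
    fin_cases i <;> simp [CHeis.mul]
  mul_one p := by
    change CHeis.mul p 0 = p
    ext i
    fin_cases i <;> simp [CHeis.mul]
  inv_mul_cancel p := by
    change CHeis.mul (CHeis.inv p) p = 0
    ext i
    fin_cases i <;> simp [CHeis.mul, CHeis.inv, Complex.exp_neg] <;> field_simp <;> ring

instance : TopologicalSpace CHeis := inferInstanceAs (TopologicalSpace (EuclideanSpace ℂ (Fin 4)))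

instance : ChartedSpace (EuclideanSpace ℂ (Fin 4)) CHeis := chartedSpaceSelf (EuclideanSpace ℂ (Fin 4))

instance : SimplyConnectedSpace CHeis := inferInstanceAs (SimplyConnectedSpace (EuclideanSpace ℂ (Fin 4)))

instance : LieGroup 𝓘(ℂ, EuclideanSpace ℂ (Fin 4)) ω CHeis where
  toIsManifold := inferInstanceAs (IsManifold 𝓘(ℂ, EuclideanSpace ℂ (Fin 4)) ω (EuclideanSpace ℂ (Fin 4)))
  contMDiff_mul := contMDiff_prod_self (m := fun p ↦ CHeis.mul p.1 p.2)
    (contDiff_euclidean.2 fun i ↦ by fin_cases i <;> simp [CHeis.mul] <;> fun_prop)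
  contMDiff_inv := ContDiff.contMDiff (f := CHeis.inv)
    (contDiff_euclidean.2 fun i ↦ by fin_cases i <;> simp [CHeis.inv] <;> fun_prop)

/-- The one-parameter subgroup `y ↦ (y, 0, 0, 0)`. -/
def oneParam : Multiplicative ℂ →* CHeis where
  toFun y := (!₂[y.toAdd, 0, 0, 0] : EuclideanSpace ℂ (Fin 4))
  map_one' := by
    change (_ : EuclideanSpace ℂ (Fin 4)) = 0
    ext i
    fin_cases i <;> simp
  map_mul' a b := by
    change _ = CHeis.mul _ _
    ext i
    fin_cases i <;> simp [CHeis.mul]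

end CHeis

/-- `ℂ² ⋉ ℂ²`; the coordinates of a point are `(y, x, z, t)`, and `(y, x)` in the first `ℂ²` acts
on `(z, t)` in the second one by `diag(e^y, e^{-y}) diag(1, e^{-x})`. -/
def C2C2 : Type := EuclideanSpace ℂ (Fin 4)

namespace C2C2

/-- The group law of `C2C2`. -/
protected def mul (p q : EuclideanSpace ℂ (Fin 4)) : EuclideanSpace ℂ (Fin 4) :=
  !₂[p 0 + q 0, p 1 + q 1, p 2 + Complex.exp (p 0) * q 2, p 3 + Complex.exp (-p 0) * Complex.exp (-p 1) * q 3]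

/-- The inverse in `C2C2`. -/
protected def inv (p : EuclideanSpace ℂ (Fin 4)) : EuclideanSpace ℂ (Fin 4) :=
  !₂[-p 0, -p 1, -(Complex.exp (-p 0) * p 2), -(Complex.exp (p 0) * Complex.exp (p 1) * p 3)]

instance : Group C2C2 where
  mul := C2C2.mul
  one := (0 : EuclideanSpace ℂ (Fin 4))
  inv := C2C2.inv
  mul_assoc p q r := by
    change C2C2.mul (C2C2.mul p q) r = C2C2.mul p (C2C2.mul q r)
    ext i
    fin_cases i <;> simp [C2C2.mul, Complex.exp_add, Complex.exp_neg] <;> field_simp <;> ring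
  one_mul p := by
    change C2C2.mul 0 p = p
    ext i
    fin_cases i <;> simp [C2C2.mul]
  mul_one p := by
    change C2C2.mul p 0 = p
    ext i
    fin_cases i <;> simp [C2C2.mul]
  inv_mul_cancel p := by
    change C2C2.mul (C2C2.inv p) p = 0
    ext i
    fin_cases i <;> simp [C2C2.mul, C2C2.inv, Complex.exp_neg]

instance : TopologicalSpace C2C2 := inferInstanceAs (TopologicalSpace (EuclideanSpace ℂ (Fin 4)))

instance : ChartedSpace (EuclideanSpace ℂ (Fin 4)) C2C2 := chartedSpaceSelf (EuclideanSpace ℂ (Fin 4))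

instance : SimplyConnectedSpace C2C2 := inferInstanceAs (SimplyConnectedSpace (EuclideanSpace ℂ (Fin 4)))

instance : LieGroup 𝓘(ℂ, EuclideanSpace ℂ (Fin 4)) ω C2C2 where
  toIsManifold := inferInstanceAs (IsManifold 𝓘(ℂ, EuclideanSpace ℂ (Fin 4)) ω (EuclideanSpace ℂ (Fin 4)))
  contMDiff_mul := contMDiff_prod_self (m := fun p ↦ C2C2.mul p.1 p.2)
    (contDiff_euclidean.2 fun i ↦ by fin_cases i <;> simp [C2C2.mul] <;> fun_prop)
  contMDiff_inv := ContDiff.contMDiff (f := C2C2.inv)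
    (contDiff_euclidean.2 fun i ↦ by fin_cases i <;> simp [C2C2.inv] <;> fun_prop)

/-- The one-parameter subgroup `y ↦ (y, 0, 0, 0)`. -/
def oneParam : Multiplicative ℂ →* C2C2 where
  toFun y := (!₂[y.toAdd, 0, 0, 0] : EuclideanSpace ℂ (Fin 4))
  map_one' := by
    change (_ : EuclideanSpace ℂ (Fin 4)) = 0
    ext i
    fin_cases i <;> simp
  map_mul' a b := by
    change _ = C2C2.mul _ _
    ext i
    fin_cases i <;> simp [C2C2.mul]

end C2C2

end Groups

end HolRiem

end

/-! Everything is read off from the adjoint action of a generator `y` of the isotropy. Since 𝒢 has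
dimension 4 and evaluates onto the three-dimensional tangent space, the isotropy is a line. The leaf
stabilizer H has dimension 3 but evaluates into the plane ker df, so it contains that line. Choose a
basis h, x, z of H with [h, z] = z and the other brackets zero, and write y = a h + β x + d z.

The crux is a ≠ 0 (`homothety_coeff_ne_zero`). If a = 0, then ad y kills x and z and sends h to -d
z. Skewness of the isotropy action for the metric, together with solvability, forces y to act
trivially on the tangent space, or else contradicts non-degeneracy. Solvability enters through
`LieModule.eigenvalue_lie_eq_zero_of_isSolvable`, a consequence of Lie's theorem: brackets have no
nonzero eigenvalue in the adjoint representation. The trivial action is excluded by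
`eq_zero_of_lie_eq_smul`: as the isotropy is a line, a generator acting trivially would have all its
brackets with 𝒢 proportional to itself, and such a field vanishing at x₀ satisfies a linear
differential inequality that makes its germ zero.

Once a ≠ 0, y can be rescaled to replace h, and it has weights 0 on x and 1 on z. Non-degeneracy
pairs the weight 1 with a weight -1, carried by a fourth vector t (`exists_lie_eq_neg`). This gives
the isotropy action diag(0, 1, -1). Weights and solvability leave only [x, t] = δ t and [z, t] = κ
x, and Jacobi gives δκ = 0 (`lie_of_weight_basis`). The three cases δ = κ = 0, δ = 0 ≠ κ, δ ≠ 0 are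
the three groups, after a rescaling of x; `isPairOf_of_bracket` identifies them by their structure
constants. -/

/-! ### Eigenvalues of brackets in a solvable Lie algebra -/

/-- An eigenvalue of a bracket `⁅a, b⁆` acting on a finite-dimensional module of a solvable Lie
algebra over `ℂ` is zero. -/
theorem LieModule.eigenvalue_lie_eq_zero_of_isSolvable {L : Type*} [LieRing L] [LieAlgebra ℂ L]
    [LieAlgebra.IsSolvable L] (a b : L) (k : ℕ) {V : Type*} [AddCommGroup V]
    [Module ℂ V] [LieRingModule L V] [LieModule ℂ L V] [FiniteDimensional ℂ V]
    (hk : Module.finrank ℂ V = k) {v : V} (hv : v ≠ 0) {α : ℂ} (h : ⁅⁅a, b⁆, v⁆ = α • v) :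
    α = 0 := by
  induction k using Nat.strong_induction_on generalizing V with
  | _ k ih =>
    have : Nontrivial V := ⟨v, 0, hv⟩
    -- Lie's theorem: a common eigenvector `u`, spanning an invariant line `N`.
    obtain ⟨χ, hχ⟩ := LieModule.exists_nontrivial_weightSpace_of_isSolvable ℂ L V
    obtain ⟨⟨u, hu⟩, hu0⟩ := exists_ne (0 : LieModule.weightSpace V χ)
    have hu0 : u ≠ 0 := fun h ↦ hu0 (Subtype.ext h)
    rw [LieModule.mem_weightSpace] at hu
    let N : LieSubmodule ℂ L V :=
      { Submodule.span ℂ {u} with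
        lie_mem := by
          intro x m hm
          obtain ⟨c, rfl⟩ := Submodule.mem_span_singleton.1 hm
          rw [lie_smul, hu]
          exact Submodule.smul_mem _ _ (Submodule.smul_mem _ _ (Submodule.mem_span_singleton_self u)) }
    -- On `N` the operators of `a` and `b` are scalars, so their commutator is zero. Off `N`, the
    -- image of `v` in `V ⧸ N` is still an eigenvector for `α`, in smaller dimension.
    by_cases hvN : v ∈ N
    · obtain ⟨c, rfl⟩ := Submodule.mem_span_singleton.1 hvN
      have h0 : ⁅⁅a, b⁆, c • u⁆ = 0 := by
        rw [lie_smul, lie_lie, hu b, hu a, lie_smul, lie_smul, hu a, hu b, smul_smul, smul_smul,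
          mul_comm, sub_self, smul_zero]
      rw [h0] at h
      exact (smul_eq_zero.1 h.symm).resolve_right hv
    · refine ih (Module.finrank ℂ (V ⧸ N)) ?_ rfl
        (v := LieSubmodule.Quotient.mk (N := N) v) ?_ ?_
      · rw [← hk]
        have h1 := Submodule.finrank_quotient_add_finrank N.toSubmodule
        have h2 : Module.finrank ℂ N.toSubmodule = 1 := finrank_span_singleton hu0
        have : Module.finrank ℂ (V ⧸ N) = Module.finrank ℂ (V ⧸ N.toSubmodule) := rfl
        omega
      · intro h0
        exact hvN ((LieSubmodule.Quotient.mk_eq_zero N).1 h0)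
      · change LieSubmodule.Quotient.mk (N := N) ⁅⁅a, b⁆, v⁆ = _
        rw [h]
        rfl

noncomputable section

namespace HolRiem

/-! ### Rigidity of a vector field vanishing at a point -/

/-- A function vanishing at a point whose derivative is bounded by a multiple of its values near
that point vanishes near that point. -/
theorem eventually_eq_zero_of_norm_fderiv_le {E F : Type*} [NormedAddCommGroup E] [NormedSpace ℂ E]
    [NormedAddCommGroup F] [NormedSpace ℂ F] {Y : E → F} {z₀ : E} {C : ℝ} (h0 : Y z₀ = 0)
    (hd : ∀ᶠ z in 𝓝 z₀, DifferentiableAt ℂ Y z) (hC : ∀ᶠ z in 𝓝 z₀, ‖fderiv ℂ Y z‖ ≤ C * ‖Y z‖) :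
    ∀ᶠ z in 𝓝 z₀, Y z = 0 := by
  obtain ⟨r, hr, hball⟩ := Metric.eventually_nhds_iff_ball.1 (hd.and hC)
  filter_upwards [Metric.ball_mem_nhds z₀ hr] with z hz
  have hmem : ∀ t ∈ Set.Icc (0 : ℝ) 1, z₀ + (t : ℂ) • (z - z₀) ∈ Metric.ball z₀ r := by
    intro t ht
    rw [mem_ball_iff_norm] at hz ⊢
    rw [add_sub_cancel_left, norm_smul, Complex.norm_real, Real.norm_of_nonneg ht.1]
    exact (mul_le_of_le_one_left (norm_nonneg _) ht.2).trans_lt hz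
  have hder : ∀ t ∈ Set.Icc (0 : ℝ) 1, HasDerivAt (fun t : ℝ ↦ Y (z₀ + (t : ℂ) • (z - z₀)))
      (fderiv ℂ Y (z₀ + (t : ℂ) • (z - z₀)) (z - z₀)) t := by
    intro t ht
    have h1 : HasDerivAt (fun s : ℝ ↦ z₀ + (s : ℂ) • (z - z₀)) (z - z₀) t := by
      simpa using ((Complex.ofRealCLM.hasDerivAt (x := t)).smul_const (z - z₀)).const_add z₀
    exact ((hball _ (hmem t ht)).1.hasFDerivAt.restrictScalars ℝ).comp_hasDerivAt t h1
  -- Grönwall's inequality along the real segment from `z₀` to `z`.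
  have := eq_zero_of_abs_deriv_le_mul_abs_self_of_eq_zero_right (a := 0) (b := 1)
    (K := C * ‖z - z₀‖) (fun t ht ↦ (hder t ht).continuousAt.continuousWithinAt)
    (fun t ht ↦ (hder t (Set.Ico_subset_Icc_self ht)).hasDerivWithinAt) (by simp [h0])
    (fun t ht ↦ by
      refine (ContinuousLinearMap.le_opNorm _ _).trans ?_
      refine (mul_le_mul_of_nonneg_right (hball _ (hmem t (Set.Ico_subset_Icc_self ht))).2
        (norm_nonneg _)).trans_eq ?_
      ring) 1 (by simp)
  simpa using this

/-- A vector field vanishing at a point, and whose brackets with the fields of a local frame are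
constant multiples of it, vanishes near that point. -/
theorem eventually_eq_zero_of_lieBracket_eq_smul {E : Type*} [NormedAddCommGroup E]
    [NormedSpace ℂ E] [FiniteDimensional ℂ E] {ι : Type*} [Fintype ι] {Y : E → E} {z₀ : E}
    (hY : ContDiffAt ℂ ω Y z₀) (h0 : Y z₀ = 0) (b : Module.Basis ι ℂ E) (V : ι → E → E)
    (hV : ∀ i, ContDiffAt ℂ ω (V i) z₀) (hb : ∀ i, V i z₀ = b i) (c : ι → ℂ)
    (hlie : ∀ i, ∀ᶠ z in 𝓝 z₀, lieBracket ℂ (V i) Y z = c i • Y z) :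
    ∀ᶠ z in 𝓝 z₀, Y z = 0 := by
  let l : ι → E →L[ℂ] ℂ := fun i ↦ LinearMap.toContinuousLinearMap (b.coord i)
  -- `Φ z` sends the basis vector `b i` to `V i z`; it is the identity at `z₀`, hence close to it
  -- nearby.
  let Φ : E → E →L[ℂ] E := fun z ↦ ∑ i, (l i).smulRight (V i z)
  let K : E → ℝ := fun z ↦ ∑ i, ‖l i‖ * (‖c i‖ + ‖fderiv ℂ (V i) z‖)
  have hΦ : ContinuousAt Φ z₀ := by
    refine tendsto_finsetSum _ fun i _ ↦ ?_
    exact ((ContinuousLinearMap.smulRightL ℂ E E (l i)).continuous.continuousAt).comp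
      (hV i).continuousAt
  have hΦ0 : Φ z₀ = ContinuousLinearMap.id ℂ E := by
    ext w
    simp only [Φ, sum_apply, ContinuousLinearMap.smulRight_apply, hb]
    exact b.sum_repr w
  have hK : ContinuousAt K z₀ := by
    refine tendsto_finsetSum _ fun i _ ↦ ?_
    have := ((hV i).fderiv_right (m := 0) (by simp)).continuousAt
    exact (this.norm.const_add _).const_mul _
  have hd : ∀ᶠ z in 𝓝 z₀, DifferentiableAt ℂ Y z := by
    filter_upwards [hY.eventually (by simp)] with z hz
    exact hz.differentiableAt (by simp)
  -- `K z₀ + 1` bounds `K` near `z₀`; the factor 2 comes from absorbing the error term `‖fderiv ℂ Y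
  -- z‖ / 2`, which is due to the distance of `Φ z` from the identity.
  refine eventually_eq_zero_of_norm_fderiv_le (C := 2 * (K z₀ + 1)) h0 hd ?_
  have e1 : ∀ᶠ z in 𝓝 z₀, ‖ContinuousLinearMap.id ℂ E - Φ z‖ < 1 / 2 := by
    have : ContinuousAt (fun z ↦ ‖ContinuousLinearMap.id ℂ E - Φ z‖) z₀ :=
      (continuousAt_const.sub hΦ).norm
    exact this.eventually_lt continuousAt_const (by simp [hΦ0])
  have e2 : ∀ᶠ z in 𝓝 z₀, K z < K z₀ + 1 := hK.eventually_lt continuousAt_const (by simp)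
  filter_upwards [e1, e2, eventually_all.2 hlie] with z h1 h2 h3
  -- The bracket hypothesis, solved for the derivative of `Y` along `V i`, is of order zero in `Y`.
  have hcomp : fderiv ℂ Y z ∘L Φ z =
      ∑ i, (l i).smulRight (c i • Y z + fderiv ℂ (V i) z (Y z)) := by
    ext w
    simp only [Φ, ContinuousLinearMap.comp_apply, sum_apply,
      ContinuousLinearMap.smulRight_apply, map_sum, map_smul, ← h3, lieBracket_eq, sub_add_cancel]
  have hbound : ‖fderiv ℂ Y z ∘L Φ z‖ ≤ K z * ‖Y z‖ := by
    rw [hcomp, Finset.sum_mul]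
    refine norm_sum_le_of_le _ fun i _ ↦ ?_
    rw [ContinuousLinearMap.norm_smulRight_apply, mul_assoc, add_mul]
    gcongr
    refine (norm_add_le _ _).trans ?_
    rw [norm_smul]
    gcongr
    exact ContinuousLinearMap.le_opNorm _ _
  have hsplit : fderiv ℂ Y z =
      fderiv ℂ Y z ∘L Φ z + fderiv ℂ Y z ∘L (ContinuousLinearMap.id ℂ E - Φ z) := by
    rw [← ContinuousLinearMap.comp_add, add_sub_cancel, ContinuousLinearMap.comp_id]
  have h4 : ‖fderiv ℂ Y z‖ ≤ K z * ‖Y z‖ + ‖fderiv ℂ Y z‖ * (1 / 2) := by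
    conv_lhs => rw [hsplit]
    refine (norm_add_le _ _).trans (add_le_add hbound ?_)
    refine (ContinuousLinearMap.opNorm_comp_le _ _).trans ?_
    gcongr
  have h5 : K z * ‖Y z‖ ≤ (K z₀ + 1) * ‖Y z‖ := by gcongr
  linarith

theorem mlieBracket_eq_lieBracket {E : Type*} [NormedAddCommGroup E] [NormedSpace ℂ E]
    (V W : Π z : E, TangentSpace 𝓘(ℂ, E) z) (z : E) :
    mlieBracket 𝓘(ℂ, E) V W z = lieBracket ℂ (V : E → E) (W : E → E) z := by
  refine (congrFun (mlieBracketWithin_univ (V := V) (W := W)) z).symm.trans ?_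
  refine (congrFun (mlieBracketWithin_eq_lieBracketWithin (s := Set.univ)) z).trans ?_
  exact congrFun lieBracketWithin_univ z

/-- A germ of vector field vanishing at `x₀`, and whose brackets with germs taking all values at
`x₀` are multiples of it, is zero. -/
theorem eq_zero_of_lie_eq_smul {E : Type*} [NormedAddCommGroup E] [NormedSpace ℂ E]
    [FiniteDimensional ℂ E] [CompleteSpace E]
    {M : Type*} [TopologicalSpace M] [ChartedSpace E M] [IsManifold 𝓘(ℂ, E) ω M] {x₀ : M}
    {v : HolGerm E x₀} (hv : ev x₀ v = 0)
    (h : ∀ t : TangentSpace 𝓘(ℂ, E) x₀, ∃ w, ev x₀ w = t ∧ ∃ c : ℂ, ⁅w, v⁆ = c • v) : v = 0 := by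
  obtain ⟨Y, rfl⟩ := germ_surjective v
  let z₀ : E := extChartAt 𝓘(ℂ, E) x₀ x₀
  let χ : E → M := (extChartAt 𝓘(ℂ, E) x₀).symm
  let P : (Π y : M, TangentSpace 𝓘(ℂ, E) y) → E → E := fun V ↦ mpullback 𝓘(ℂ, E) 𝓘(ℂ, E) χ V
  have hχ0 : χ z₀ = x₀ := extChartAt_to_inv x₀
  have hχ : ContMDiffAt 𝓘(ℂ, E) 𝓘(ℂ, E) ω χ z₀ := by
    have := contMDiffWithinAt_extChartAt_symm_range_self (I := 𝓘(ℂ, E)) (n := ω) x₀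
    rwa [modelWithCornersSelf_coe, Set.range_id, contMDiffWithinAt_univ] at this
  have hinv : ∀ z ∈ (extChartAt 𝓘(ℂ, E) x₀).target,
      (mfderiv 𝓘(ℂ, E) 𝓘(ℂ, E) χ z).IsInvertible := by
    intro z hz
    have := isInvertible_mfderivWithin_extChartAt_symm (I := 𝓘(ℂ, E)) hz
    rwa [modelWithCornersSelf_coe, Set.range_id, mfderivWithin_univ] at this
  have htarget : (extChartAt 𝓘(ℂ, E) x₀).target ∈ 𝓝 z₀ := extChartAt_target_mem_nhds x₀
  have hz₀ := mem_of_mem_nhds htarget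
  have hP : ∀ V, HolAt V x₀ → ContDiffAt ℂ ω (P V) z₀ := by
    intro V hV
    have := ContMDiffAt.mpullback_vectorField_preimage (m := ω) (n := ω) (f := χ) (x₀ := z₀)
      (V := V) (by rw [hχ0]; exact hV) hχ (hinv z₀ hz₀) (by simp)
    exact contMDiffAt_vectorSpace_iff_contDiffAt.1 this
  have htend : Tendsto χ (𝓝 z₀) (𝓝 x₀) := by
    have := hχ.continuousAt
    rwa [ContinuousAt, hχ0] at this
  let b := Module.finBasis ℂ E
  let D : E →L[ℂ] E := mfderiv 𝓘(ℂ, E) 𝓘(ℂ, E) χ z₀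
  -- The values `D (b i)` are chosen so that in the chart the fields form a frame equal to `b` at
  -- `z₀`.
  choose w hw c hc using fun i ↦ h (D (b i))
  choose W hW using fun i ↦ germ_surjective (w i)
  have hzero : ∀ᶠ z in 𝓝 z₀, P Y.1 z = 0 := by
    refine eventually_eq_zero_of_lieBracket_eq_smul (hP _ Y.2) ?_ b (fun i ↦ P (W i).1)
      (fun i ↦ hP _ (W i).2) (fun i ↦ ?_) c (fun i ↦ ?_)
    · have h1 : (Y.1 : M → E) (χ z₀) = 0 := by
        rw [hχ0]
        exact hv
      exact (congrArg D.inverse h1).trans (map_zero _)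
    · have h1 : ((W i).1 : M → E) (χ z₀) = D (b i) := by
        rw [hχ0, ← hw i, ← hW i]
        rfl
      change D.inverse (((W i).1 : M → E) (χ z₀)) = b i
      rw [h1]
      have h2 : D.inverse ∘L D = ContinuousLinearMap.id ℂ E := (hinv z₀ hz₀).inverse_comp_self
      exact congrArg (fun A : E →L[ℂ] E ↦ A (b i)) h2
    · have h1 := hc i
      rw [← hW i, germ_lie, ← map_smul, germ_eq_iff] at h1
      filter_upwards [htend.eventually h1, htend.eventually (HolAt.of_mem (V := W i)),
        htend.eventually (HolAt.of_mem (V := Y)),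
        (contMDiffAt_iff_contMDiffAt_nhds (by simp)).1 hχ] with z h1 h2 h3 h4
      have h5 := mpullback_mlieBracket (V := (W i).1) (W := Y.1) h2.mdiff h3.mdiff h4 (by simp)
      refine (mlieBracket_eq_lieBracket _ _ z).symm.trans (h5.symm.trans ?_)
      have h6 : mlieBracket 𝓘(ℂ, E) (W i).1 Y.1 (χ z) = c i • Y.1 (χ z) := h1
      rw [mpullback_apply, h6, map_smul]
      rfl
  rw [← map_zero (germ (E := E) x₀), germ_eq_iff]
  -- The pullback is the field composed with an invertible derivative, so its vanishing is that of
  -- the field.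
  have hzero' : ∀ᶠ z in 𝓝 z₀, Y.1 (χ z) = 0 := by
    filter_upwards [hzero, htarget] with z h1 h2
    have h3 : (mfderiv 𝓘(ℂ, E) 𝓘(ℂ, E) χ z).inverse (Y.1 (χ z)) = 0 := h1
    have h4 := congrArg (fun A ↦ A (Y.1 (χ z))) (hinv z h2).self_comp_inverse
    refine h4.symm.trans ?_
    change mfderiv 𝓘(ℂ, E) 𝓘(ℂ, E) χ z ((mfderiv 𝓘(ℂ, E) 𝓘(ℂ, E) χ z).inverse (Y.1 (χ z))) = 0
    rw [h3, map_zero]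
  filter_upwards [(continuousAt_extChartAt x₀).eventually hzero',
    extChartAt_source_mem_nhds (I := 𝓘(ℂ, E)) x₀] with y h1 h2
  rwa [show χ (extChartAt 𝓘(ℂ, E) x₀ y) = y from (extChartAt 𝓘(ℂ, E) x₀).left_inv h2] at h1

/-! ### Lie algebras of the model groups -/

/-- The Lie algebra bracket of a Lie group modelled on itself, where `L p` is the derivative at the
identity of the left translation by `p`, and `D w` that of the left-invariant field of `w`. -/
theorem groupLieAlgebra_bracket {F : Type*} [NormedAddCommGroup F] [NormedSpace ℂ F] [Group F]
    (L : F → F →L[ℂ] F) (hL : ∀ p, HasFDerivAt (fun q : F ↦ p * q) (L p) (1 : F))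
    (D : F → F →L[ℂ] F) (hD : ∀ w, HasFDerivAt (fun p ↦ L p w) (D w) (1 : F))
    (v w : GroupLieAlgebra 𝓘(ℂ, F) F) :
    (⁅v, w⁆ : GroupLieAlgebra 𝓘(ℂ, F) F) = D w v - D v w := by
  let X : F → F → F := fun u ↦ mulInvariantVectorField (I := 𝓘(ℂ, F)) (G := F) u
  have key : ∀ u : F, X u = fun p ↦ L p u := by
    intro u
    funext p
    change mfderiv 𝓘(ℂ, F) 𝓘(ℂ, F) (fun q : F ↦ p * q) 1 u = _
    rw [mfderiv_eq_fderiv, (hL p).fderiv]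
    rfl
  have h1 : L 1 = ContinuousLinearMap.id ℂ F := by
    have := hL 1
    simp only [one_mul] at this
    exact this.unique (hasFDerivAt_id _)
  have main : ∀ v w : F, lieBracket ℂ (X v) (X w) 1 = D w v - D v w := by
    intro v w
    simp only [key, lieBracket_eq, (hD _).fderiv, h1, ContinuousLinearMap.id_apply]
  exact (mlieBracket_eq_lieBracket (X v) (X w) 1).trans (main v w)

/-- The continuous linear map into `ℂⁿ` with the given coordinates. -/
def euclideanPi {F : Type*} [NormedAddCommGroup F] [NormedSpace ℂ F] {n : ℕ}
    (a : Fin n → F →L[ℂ] ℂ) : F →L[ℂ] EuclideanSpace ℂ (Fin n) :=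
  (EuclideanSpace.equiv (Fin n) ℂ).symm.toContinuousLinearMap ∘L ContinuousLinearMap.pi a

theorem hasFDerivAt_euclideanPi {F : Type*} [NormedAddCommGroup F] [NormedSpace ℂ F] {n : ℕ}
    {f : F → EuclideanSpace ℂ (Fin n)} {a : Fin n → F →L[ℂ] ℂ} {x : F}
    (h : ∀ i, HasFDerivAt (fun y ↦ f y i) (a i) x) : HasFDerivAt f (euclideanPi a) x :=
  hasFDerivWithinAt_univ.1 (hasFDerivWithinAt_euclidean.2 fun i ↦ (h i).hasFDerivWithinAt)

/-- The `i`-th coordinate on `ℂⁿ`. -/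
abbrev eproj {n : ℕ} (i : Fin n) : EuclideanSpace ℂ (Fin n) →L[ℂ] ℂ := EuclideanSpace.proj i

theorem hasFDerivAt_exp_coord {n : ℕ} (i : Fin n) :
    HasFDerivAt (fun p : EuclideanSpace ℂ (Fin n) ↦ Complex.exp (p i)) (eproj i) 0 := by
  simpa using ((eproj i).hasFDerivAt (x := (0 : EuclideanSpace ℂ (Fin n)))).cexp

theorem hasFDerivAt_exp_neg_coord {n : ℕ} (i : Fin n) :
    HasFDerivAt (fun p : EuclideanSpace ℂ (Fin n) ↦ Complex.exp (-p i)) (-eproj i) 0 := by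
  simpa using ((eproj i).hasFDerivAt (x := (0 : EuclideanSpace ℂ (Fin n)))).neg.cexp

/-- Left translation by `p` has derivative diag(1, 1, exp (p 0)) at the identity. Its variation in
`p` at the identity, applied to `w`, is the last component `w 2 • eproj 0`; antisymmetrizing gives
the bracket. The three four-dimensional groups are treated in the same way. -/
theorem CAG.bracket (v w : GroupLieAlgebra 𝓘(ℂ, EuclideanSpace ℂ (Fin 3)) CAG) :
    ⁅v, w⁆ = (fun v w : EuclideanSpace ℂ (Fin 3) ↦
      (!₂[0, 0, v 0 * w 2 - w 0 * v 2] : EuclideanSpace ℂ (Fin 3))) v w := by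
  refine (@groupLieAlgebra_bracket (EuclideanSpace ℂ (Fin 3)) _ _ (inferInstanceAs (Group CAG))
    (fun p ↦ euclideanPi ![eproj 0, eproj 1, Complex.exp (p 0) • eproj 2])
    (fun p ↦ hasFDerivAt_euclideanPi ?_)
    (fun w ↦ euclideanPi ![0, 0, w 2 • eproj 0])
    (fun w ↦ hasFDerivAt_euclideanPi ?_) v w).trans ?_
  · intro i
    fin_cases i
    · exact (eproj 0).hasFDerivAt.const_add (p 0)
    · exact (eproj 1).hasFDerivAt.const_add (p 1)
    · exact ((eproj 2).hasFDerivAt.const_mul (Complex.exp (p 0))).const_add (p 2)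
  · intro i
    fin_cases i
    · exact hasFDerivAt_const _ _
    · exact hasFDerivAt_const _ _
    · exact (hasFDerivAt_exp_coord 0).mul_const (w 2)
  · have (v w : EuclideanSpace ℂ (Fin 3)) : euclideanPi ![0, 0, w 2 • eproj 0] v -
        euclideanPi ![0, 0, v 2 • eproj 0] w = !₂[0, 0, v 0 * w 2 - w 0 * v 2] := by
      ext i
      fin_cases i <;> simp [euclideanPi]
      all_goals ring
    exact this v w

theorem CAG.velocity_oneParam : velocity (EuclideanSpace ℂ (Fin 3)) CAG.oneParam =
    EuclideanSpace.single (0 : Fin 3) (1 : ℂ) := by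
  have h : HasFDerivAt (fun s : ℂ ↦ (!₂[s, 0, 0] : EuclideanSpace ℂ (Fin 3)))
      (euclideanPi ![ContinuousLinearMap.id ℂ ℂ, 0, 0]) 0 := by
    refine hasFDerivAt_euclideanPi fun i ↦ ?_
    fin_cases i
    · exact hasFDerivAt_id _
    · exact hasFDerivAt_const _ _
    · exact hasFDerivAt_const _ _
  change mfderiv 𝓘(ℂ, ℂ) 𝓘(ℂ, EuclideanSpace ℂ (Fin 3))
    (fun s : ℂ ↦ (!₂[s, 0, 0] : EuclideanSpace ℂ (Fin 3))) 0 (1 : ℂ) = _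
  rw [mfderiv_eq_fderiv, h.fderiv]
  have : euclideanPi ![ContinuousLinearMap.id ℂ ℂ, 0, 0] (1 : ℂ) =
      EuclideanSpace.single (0 : Fin 3) (1 : ℂ) := by
    ext i
    fin_cases i <;> simp [euclideanPi]
  exact this

theorem CSol.bracket (v w : GroupLieAlgebra 𝓘(ℂ, EuclideanSpace ℂ (Fin 4)) CSol) :
    ⁅v, w⁆ = (fun v w : EuclideanSpace ℂ (Fin 4) ↦
      (!₂[0, 0, v 0 * w 2 - w 0 * v 2, w 0 * v 3 - v 0 * w 3] : EuclideanSpace ℂ (Fin 4))) v w := by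
  refine (@groupLieAlgebra_bracket (EuclideanSpace ℂ (Fin 4)) _ _ (inferInstanceAs (Group CSol))
    (fun p ↦ euclideanPi ![eproj 0, eproj 1, Complex.exp (p 0) • eproj 2, Complex.exp (-p 0) • eproj 3])
    (fun p ↦ hasFDerivAt_euclideanPi ?_)
    (fun w ↦ euclideanPi ![0, 0, w 2 • eproj 0, w 3 • -eproj 0])
    (fun w ↦ hasFDerivAt_euclideanPi ?_) v w).trans ?_
  · intro i
    fin_cases i
    · exact (eproj 0).hasFDerivAt.const_add (p 0)
    · exact (eproj 1).hasFDerivAt.const_add (p 1)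
    · exact ((eproj 2).hasFDerivAt.const_mul (Complex.exp (p 0))).const_add (p 2)
    · exact ((eproj 3).hasFDerivAt.const_mul (Complex.exp (-p 0))).const_add (p 3)
  · intro i
    fin_cases i
    · exact hasFDerivAt_const _ _
    · exact hasFDerivAt_const _ _
    · exact (hasFDerivAt_exp_coord 0).mul_const (w 2)
    · exact (hasFDerivAt_exp_neg_coord 0).mul_const (w 3)
  · have (v w : EuclideanSpace ℂ (Fin 4)) : euclideanPi ![0, 0, w 2 • eproj 0, w 3 • -eproj 0] v -
        euclideanPi ![0, 0, v 2 • eproj 0, v 3 • -eproj 0] w = !₂[0, 0, v 0 * w 2 - w 0 * v 2, w 0 * v 3 - v 0 * w 3] := by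
      ext i
      fin_cases i <;> simp [euclideanPi]
      all_goals ring
    exact this v w

theorem CSol.velocity_oneParam : velocity (EuclideanSpace ℂ (Fin 4)) CSol.oneParam =
    EuclideanSpace.single (0 : Fin 4) (1 : ℂ) := by
  have h : HasFDerivAt (fun s : ℂ ↦ (!₂[s, 0, 0, 0] : EuclideanSpace ℂ (Fin 4)))
      (euclideanPi ![ContinuousLinearMap.id ℂ ℂ, 0, 0, 0]) 0 := by
    refine hasFDerivAt_euclideanPi fun i ↦ ?_
    fin_cases i
    · exact hasFDerivAt_id _
    · exact hasFDerivAt_const _ _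
    · exact hasFDerivAt_const _ _
    · exact hasFDerivAt_const _ _
  change mfderiv 𝓘(ℂ, ℂ) 𝓘(ℂ, EuclideanSpace ℂ (Fin 4))
    (fun s : ℂ ↦ (!₂[s, 0, 0, 0] : EuclideanSpace ℂ (Fin 4))) 0 (1 : ℂ) = _
  rw [mfderiv_eq_fderiv, h.fderiv]
  have : euclideanPi ![ContinuousLinearMap.id ℂ ℂ, 0, 0, 0] (1 : ℂ) =
      EuclideanSpace.single (0 : Fin 4) (1 : ℂ) := by
    ext i
    fin_cases i <;> simp [euclideanPi]
  exact this

theorem CHeis.bracket (v w : GroupLieAlgebra 𝓘(ℂ, EuclideanSpace ℂ (Fin 4)) CHeis) :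
    ⁅v, w⁆ = (fun v w : EuclideanSpace ℂ (Fin 4) ↦
      (!₂[0, v 3 * w 2 - w 3 * v 2, v 0 * w 2 - w 0 * v 2, w 0 * v 3 - v 0 * w 3] : EuclideanSpace ℂ (Fin 4))) v w := by
  refine (@groupLieAlgebra_bracket (EuclideanSpace ℂ (Fin 4)) _ _ (inferInstanceAs (Group CHeis))
    (fun p ↦ euclideanPi ![eproj 0, eproj 1 + p 3 • Complex.exp (p 0) • eproj 2, Complex.exp (p 0) • eproj 2, Complex.exp (-p 0) • eproj 3])
    (fun p ↦ hasFDerivAt_euclideanPi ?_)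
    (fun w ↦ euclideanPi ![0, w 2 • eproj 3, w 2 • eproj 0, w 3 • -eproj 0])
    (fun w ↦ hasFDerivAt_euclideanPi ?_) v w).trans ?_
  · intro i
    fin_cases i
    · exact (eproj 0).hasFDerivAt.const_add (p 0)
    · exact ((eproj 1).hasFDerivAt.const_add (p 1)).add (((eproj 2).hasFDerivAt.const_mul (Complex.exp (p 0))).const_mul (p 3))
    · exact ((eproj 2).hasFDerivAt.const_mul (Complex.exp (p 0))).const_add (p 2)
    · exact ((eproj 3).hasFDerivAt.const_mul (Complex.exp (-p 0))).const_add (p 3)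
  · intro i
    fin_cases i
    · exact hasFDerivAt_const _ _
    -- The factor `y 3` vanishes at the identity, so only its own derivative contributes, with the
    -- exponential equal to 1.
    · exact by
        have : HasFDerivAt (fun y : EuclideanSpace ℂ (Fin 4) ↦
            w 1 + y 3 * (Complex.exp (y 0) * w 2)) (w 2 • eproj 3) 0 := by
          refine ((((eproj 3).hasFDerivAt (x := (0 : EuclideanSpace ℂ (Fin 4)))).mul
            ((hasFDerivAt_exp_coord 0).mul_const (w 2))).const_add (w 1)).congr_fderiv ?_
          simp
        exact this
    · exact (hasFDerivAt_exp_coord 0).mul_const (w 2)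
    · exact (hasFDerivAt_exp_neg_coord 0).mul_const (w 3)
  · have (v w : EuclideanSpace ℂ (Fin 4)) : euclideanPi ![0, w 2 • eproj 3, w 2 • eproj 0, w 3 • -eproj 0] v -
        euclideanPi ![0, v 2 • eproj 3, v 2 • eproj 0, v 3 • -eproj 0] w = !₂[0, v 3 * w 2 - w 3 * v 2, v 0 * w 2 - w 0 * v 2, w 0 * v 3 - v 0 * w 3] := by
      ext i
      fin_cases i <;> simp [euclideanPi]
      all_goals ring
    exact this v w

theorem CHeis.velocity_oneParam : velocity (EuclideanSpace ℂ (Fin 4)) CHeis.oneParam =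
    EuclideanSpace.single (0 : Fin 4) (1 : ℂ) := by
  have h : HasFDerivAt (fun s : ℂ ↦ (!₂[s, 0, 0, 0] : EuclideanSpace ℂ (Fin 4)))
      (euclideanPi ![ContinuousLinearMap.id ℂ ℂ, 0, 0, 0]) 0 := by
    refine hasFDerivAt_euclideanPi fun i ↦ ?_
    fin_cases i
    · exact hasFDerivAt_id _
    · exact hasFDerivAt_const _ _
    · exact hasFDerivAt_const _ _
    · exact hasFDerivAt_const _ _
  change mfderiv 𝓘(ℂ, ℂ) 𝓘(ℂ, EuclideanSpace ℂ (Fin 4))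
    (fun s : ℂ ↦ (!₂[s, 0, 0, 0] : EuclideanSpace ℂ (Fin 4))) 0 (1 : ℂ) = _
  rw [mfderiv_eq_fderiv, h.fderiv]
  have : euclideanPi ![ContinuousLinearMap.id ℂ ℂ, 0, 0, 0] (1 : ℂ) =
      EuclideanSpace.single (0 : Fin 4) (1 : ℂ) := by
    ext i
    fin_cases i <;> simp [euclideanPi]
  exact this

theorem C2C2.bracket (v w : GroupLieAlgebra 𝓘(ℂ, EuclideanSpace ℂ (Fin 4)) C2C2) :
    ⁅v, w⁆ = (fun v w : EuclideanSpace ℂ (Fin 4) ↦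
      (!₂[0, 0, v 0 * w 2 - w 0 * v 2, (w 0 + w 1) * v 3 - (v 0 + v 1) * w 3] : EuclideanSpace ℂ (Fin 4))) v w := by
  refine (@groupLieAlgebra_bracket (EuclideanSpace ℂ (Fin 4)) _ _ (inferInstanceAs (Group C2C2))
    (fun p ↦ euclideanPi ![eproj 0, eproj 1, Complex.exp (p 0) • eproj 2, (Complex.exp (-p 0) * Complex.exp (-p 1)) • eproj 3])
    (fun p ↦ hasFDerivAt_euclideanPi ?_)
    (fun w ↦ euclideanPi ![0, 0, w 2 • eproj 0, w 3 • (-eproj 0 - eproj 1)])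
    (fun w ↦ hasFDerivAt_euclideanPi ?_) v w).trans ?_
  · intro i
    fin_cases i
    · exact (eproj 0).hasFDerivAt.const_add (p 0)
    · exact (eproj 1).hasFDerivAt.const_add (p 1)
    · exact ((eproj 2).hasFDerivAt.const_mul (Complex.exp (p 0))).const_add (p 2)
    · exact ((eproj 3).hasFDerivAt.const_mul (Complex.exp (-p 0) * Complex.exp (-p 1))).const_add (p 3)
  · intro i
    fin_cases i
    · exact hasFDerivAt_const _ _
    · exact hasFDerivAt_const _ _
    · exact (hasFDerivAt_exp_coord 0).mul_const (w 2)
    · exact by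
        have : HasFDerivAt (fun y : EuclideanSpace ℂ (Fin 4) ↦
            Complex.exp (-y 0) * Complex.exp (-y 1) * w 3) (w 3 • (-eproj 0 - eproj 1)) 0 := by
          refine (((hasFDerivAt_exp_neg_coord (n := 4) 0).mul
            (hasFDerivAt_exp_neg_coord 1)).mul_const (w 3)).congr_fderiv ?_
          simp only [PiLp.zero_apply, neg_zero, Complex.exp_zero, one_smul]
          module
        exact this
  · have (v w : EuclideanSpace ℂ (Fin 4)) : euclideanPi ![0, 0, w 2 • eproj 0, w 3 • (-eproj 0 - eproj 1)] v -
        euclideanPi ![0, 0, v 2 • eproj 0, v 3 • (-eproj 0 - eproj 1)] w = !₂[0, 0, v 0 * w 2 - w 0 * v 2, (w 0 + w 1) * v 3 - (v 0 + v 1) * w 3] := by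
      ext i
      fin_cases i <;> simp [euclideanPi]
      all_goals ring
    exact this v w

theorem C2C2.velocity_oneParam : velocity (EuclideanSpace ℂ (Fin 4)) C2C2.oneParam =
    EuclideanSpace.single (0 : Fin 4) (1 : ℂ) := by
  have h : HasFDerivAt (fun s : ℂ ↦ (!₂[s, 0, 0, 0] : EuclideanSpace ℂ (Fin 4)))
      (euclideanPi ![ContinuousLinearMap.id ℂ ℂ, 0, 0, 0]) 0 := by
    refine hasFDerivAt_euclideanPi fun i ↦ ?_
    fin_cases i
    · exact hasFDerivAt_id _
    · exact hasFDerivAt_const _ _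
    · exact hasFDerivAt_const _ _
    · exact hasFDerivAt_const _ _
  change mfderiv 𝓘(ℂ, ℂ) 𝓘(ℂ, EuclideanSpace ℂ (Fin 4))
    (fun s : ℂ ↦ (!₂[s, 0, 0, 0] : EuclideanSpace ℂ (Fin 4))) 0 (1 : ℂ) = _
  rw [mfderiv_eq_fderiv, h.fderiv]
  have : euclideanPi ![ContinuousLinearMap.id ℂ ℂ, 0, 0, 0] (1 : ℂ) =
      EuclideanSpace.single (0 : Fin 4) (1 : ℂ) := by
    ext i
    fin_cases i <;> simp [euclideanPi]
  exact this

/-! ### Recognition of the model pairs by structure constants -/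

/-- Recognition of a pair (group, one-parameter subgroup) by the structure constants of its Lie
algebra. -/
theorem isPairOf_of_bracket {n : ℕ} {G : Type*} [TopologicalSpace G]
    [ChartedSpace (EuclideanSpace ℂ (Fin n)) G] [Group G]
    [LieGroup 𝓘(ℂ, EuclideanSpace ℂ (Fin n)) ω G] [SimplyConnectedSpace G]
    {L : Type*} [LieRing L] [LieAlgebra ℂ L]
    {β : EuclideanSpace ℂ (Fin n) → EuclideanSpace ℂ (Fin n) → EuclideanSpace ℂ (Fin n)}
    (hβ : ∀ v w : GroupLieAlgebra 𝓘(ℂ, EuclideanSpace ℂ (Fin n)) G, ⁅v, w⁆ = β v w)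
    {γ : Multiplicative ℂ →* G} {i : Fin n}
    (hγ : velocity (EuclideanSpace ℂ (Fin n)) γ = EuclideanSpace.single i (1 : ℂ))
    {u : Fin n → L} (hu : LinearIndependent ℂ u)
    (hlie : ∀ v w : EuclideanSpace ℂ (Fin n),
      ∑ j, β v w j • u j = ⁅∑ j, v j • u j, ∑ j, w j • u j⁆) :
    IsPairOf (EuclideanSpace ℂ (Fin n)) γ (Submodule.span ℂ (Set.range u))
      (Submodule.span ℂ {u i}) := by
  -- The linear map sending the standard basis to `u`; `hlie` says that it respects brackets.
  let ψ : EuclideanSpace ℂ (Fin n) →ₗ[ℂ] L :=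
    Fintype.linearCombination ℂ u ∘ₗ (EuclideanSpace.equiv (Fin n) ℂ).toLinearMap
  let φ : GroupLieAlgebra 𝓘(ℂ, EuclideanSpace ℂ (Fin n)) G →ₗ⁅ℂ⁆ L :=
    { (ψ : GroupLieAlgebra 𝓘(ℂ, EuclideanSpace ℂ (Fin n)) G →ₗ[ℂ] L) with
      map_lie' := by
        intro v w
        rw [hβ]
        exact hlie v w }
  refine ⟨φ, ⟨inferInstance, ?_, ?_⟩, ?_⟩
  · have : Function.Injective ψ :=
      (linearIndependent_iff_injective_fintypeLinearCombination.1 hu).comp (EuclideanSpace.equiv (Fin n) ℂ).injective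
    exact this
  · have : LinearMap.range ψ = Submodule.span ℂ (Set.range u) := by
      rw [← Fintype.range_linearCombination]
      exact LinearMap.range_comp_of_range_eq_top _
        (LinearMap.range_eq_top.2 (EuclideanSpace.equiv (Fin n) ℂ).surjective)
    exact this
  · rw [hγ]
    have : ψ (EuclideanSpace.single i 1) = u i := by
      simp [ψ, Fintype.linearCombination_apply]
    exact congrArg (fun a ↦ Submodule.span ℂ {a}) this.symm

theorem CAG.isPairOf {L : Type*} [LieRing L] [LieAlgebra ℂ L] {y x z : L}
    (hu : LinearIndependent ℂ ![y, x, z])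
    (hyx : ⁅y, x⁆ = 0)
    (hyz : ⁅y, z⁆ = z)
    (hxz : ⁅x, z⁆ = 0) :
    IsPairOf (EuclideanSpace ℂ (Fin 3)) CAG.oneParam
      (Submodule.span ℂ (Set.range ![y, x, z])) (Submodule.span ℂ {y}) := by
  refine isPairOf_of_bracket CAG.bracket CAG.velocity_oneParam hu fun v w ↦ ?_
  have hyx' : ⁅x, y⁆ = -(0) := by rw [← lie_skew, hyx]
  have hyz' : ⁅z, y⁆ = -(z) := by rw [← lie_skew, hyz]
  have hxz' : ⁅z, x⁆ = -(0) := by rw [← lie_skew, hxz]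
  simp [Fin.sum_univ_succ, hyx, hyx', hyz, hyz', hxz, hxz']
  module

theorem CSol.isPairOf {L : Type*} [LieRing L] [LieAlgebra ℂ L] {y x z t : L}
    (hu : LinearIndependent ℂ ![y, x, z, t])
    (hyx : ⁅y, x⁆ = 0)
    (hyz : ⁅y, z⁆ = z)
    (hyt : ⁅y, t⁆ = -t)
    (hxz : ⁅x, z⁆ = 0)
    (hxt : ⁅x, t⁆ = 0)
    (hzt : ⁅z, t⁆ = 0) :
    IsPairOf (EuclideanSpace ℂ (Fin 4)) CSol.oneParam
      (Submodule.span ℂ (Set.range ![y, x, z, t])) (Submodule.span ℂ {y}) := by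
  refine isPairOf_of_bracket CSol.bracket CSol.velocity_oneParam hu fun v w ↦ ?_
  have hyx' : ⁅x, y⁆ = -(0) := by rw [← lie_skew, hyx]
  have hyz' : ⁅z, y⁆ = -(z) := by rw [← lie_skew, hyz]
  have hyt' : ⁅t, y⁆ = -(-t) := by rw [← lie_skew, hyt]
  have hxz' : ⁅z, x⁆ = -(0) := by rw [← lie_skew, hxz]
  have hxt' : ⁅t, x⁆ = -(0) := by rw [← lie_skew, hxt]
  have hzt' : ⁅t, z⁆ = -(0) := by rw [← lie_skew, hzt]
  simp [Fin.sum_univ_succ, hyx, hyx', hyz, hyz', hyt, hyt', hxz, hxz', hxt, hxt', hzt, hzt']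
  module

theorem CHeis.isPairOf {L : Type*} [LieRing L] [LieAlgebra ℂ L] {y x z t : L}
    (hu : LinearIndependent ℂ ![y, x, z, t])
    (hyx : ⁅y, x⁆ = 0)
    (hyz : ⁅y, z⁆ = z)
    (hyt : ⁅y, t⁆ = -t)
    (hxz : ⁅x, z⁆ = 0)
    (hxt : ⁅x, t⁆ = 0)
    (hzt : ⁅z, t⁆ = -x) :
    IsPairOf (EuclideanSpace ℂ (Fin 4)) CHeis.oneParam
      (Submodule.span ℂ (Set.range ![y, x, z, t])) (Submodule.span ℂ {y}) := by
  refine isPairOf_of_bracket CHeis.bracket CHeis.velocity_oneParam hu fun v w ↦ ?_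
  have hyx' : ⁅x, y⁆ = -(0) := by rw [← lie_skew, hyx]
  have hyz' : ⁅z, y⁆ = -(z) := by rw [← lie_skew, hyz]
  have hyt' : ⁅t, y⁆ = -(-t) := by rw [← lie_skew, hyt]
  have hxz' : ⁅z, x⁆ = -(0) := by rw [← lie_skew, hxz]
  have hxt' : ⁅t, x⁆ = -(0) := by rw [← lie_skew, hxt]
  have hzt' : ⁅t, z⁆ = -(-x) := by rw [← lie_skew, hzt]
  simp [Fin.sum_univ_succ, hyx, hyx', hyz, hyz', hyt, hyt', hxz, hxz', hxt, hxt', hzt, hzt']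
  module

theorem C2C2.isPairOf {L : Type*} [LieRing L] [LieAlgebra ℂ L] {y x z t : L}
    (hu : LinearIndependent ℂ ![y, x, z, t])
    (hyx : ⁅y, x⁆ = 0)
    (hyz : ⁅y, z⁆ = z)
    (hyt : ⁅y, t⁆ = -t)
    (hxz : ⁅x, z⁆ = 0)
    (hxt : ⁅x, t⁆ = -t)
    (hzt : ⁅z, t⁆ = 0) :
    IsPairOf (EuclideanSpace ℂ (Fin 4)) C2C2.oneParam
      (Submodule.span ℂ (Set.range ![y, x, z, t])) (Submodule.span ℂ {y}) := by
  refine isPairOf_of_bracket C2C2.bracket C2C2.velocity_oneParam hu fun v w ↦ ?_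
  have hyx' : ⁅x, y⁆ = -(0) := by rw [← lie_skew, hyx]
  have hyz' : ⁅z, y⁆ = -(z) := by rw [← lie_skew, hyz]
  have hyt' : ⁅t, y⁆ = -(-t) := by rw [← lie_skew, hyt]
  have hxz' : ⁅z, x⁆ = -(0) := by rw [← lie_skew, hxz]
  have hxt' : ⁅t, x⁆ = -(-t) := by rw [← lie_skew, hxt]
  have hzt' : ⁅t, z⁆ = -(0) := by rw [← lie_skew, hzt]
  simp [Fin.sum_univ_succ, hyx, hyx', hyz, hyz', hyt, hyt', hxz, hxz', hxt, hxt', hzt, hzt']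
  module

/-! ### The isotropy action and its skewness -/

section Germs

variable {E : Type*} [NormedAddCommGroup E] [NormedSpace ℂ E] [CompleteSpace E]
  {M : Type*} [TopologicalSpace M] [ChartedSpace E M] [IsManifold 𝓘(ℂ, E) ω M] {x₀ : M}

/-- The germs vanishing at `x₀` are closed under the bracket. -/
theorem ev_lie_eq_zero {v w : HolGerm E x₀} (hv : ev x₀ v = 0) (hw : ev x₀ w = 0) :
    ev x₀ ⁅v, w⁆ = 0 := by
  obtain ⟨V, rfl⟩ := germ_surjective v
  obtain ⟨W, rfl⟩ := germ_surjective w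
  rw [germ_lie, ev_germ]
  change mlieBracket 𝓘(ℂ, E) V.1 W.1 x₀ = 0
  rw [← mlieBracketWithin_univ]
  exact mlieBracketWithin_eq_zero_of_eq_zero hv hw

/-- The value of `⁅v, w⁆` at `x₀` depends only on that of `w`: two choices of `w` differ by a germ
vanishing at `x₀`, and so does its bracket with `v`. A linear section of the evaluation then defines
the action. -/
theorem exists_isIsotropyAction (hsurj : Function.Surjective (ev (E := E) x₀))
    {v : HolGerm E x₀} (hv : ev x₀ v = 0) : ∃ A, IsIsotropyAction v A := by
  obtain ⟨s, hs⟩ := (ev (E := E) x₀).exists_rightInverse_of_surjective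
    (LinearMap.range_eq_top.2 hsurj)
  refine ⟨(ev x₀ ∘ₗ (LieAlgebra.ad ℂ (HolGerm E x₀) v : HolGerm E x₀ →ₗ[ℂ] HolGerm E x₀)) ∘ₗ s,
    fun w ↦ ?_⟩
  have h1 : ev x₀ (w - s (ev x₀ w)) = 0 := by
    rw [map_sub, sub_eq_zero]
    exact (LinearMap.congr_fun hs (ev x₀ w)).symm
  have h2 := ev_lie_eq_zero hv h1
  rw [lie_sub, map_sub, sub_eq_zero] at h2
  exact h2

/-- The isotropy action of a Killing field is skew for the metric. -/
theorem killingAlgebra_form_skew (g : HolRiemannianMetric E M) {v : HolGerm E x₀}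
    (hv : v ∈ killingAlgebra g x₀) (hv0 : ev x₀ v = 0) (w₁ w₂ : HolGerm E x₀) :
    g.form x₀ (ev x₀ ⁅v, w₁⁆) (ev x₀ w₂) + g.form x₀ (ev x₀ w₁) (ev x₀ ⁅v, w₂⁆) = 0 := by
  obtain ⟨V, rfl, hV⟩ := hv
  obtain ⟨A, rfl⟩ := germ_surjective w₁
  obtain ⟨B, rfl⟩ := germ_surjective w₂
  have h := (hV A.1 B.1 A.2 B.2).self_of_nhds
  -- The left side of the Killing equation differentiates along the zero vector at `x₀`.
  have h0 : lieDeriv V.1 (g.apply A.1 B.1) x₀ = 0 := by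
    have : V.1 x₀ = 0 := hv0
    rw [lieDeriv, this, map_zero]
  rw [h0] at h
  exact h.symm

end Germs

/-! ### Linear algebra of a four-dimensional transitive algebra with a metric -/

section Algebra

variable {L T : Type*} [LieRing L] [LieAlgebra ℂ L] [AddCommGroup T] [Module ℂ T]

theorem basis_four_repr (b : Module.Basis (Fin 4) ℂ L) (v : L) :
    ∃ p q r s : ℂ, v = p • b 0 + q • b 1 + r • b 2 + s • b 3 := by
  refine ⟨b.repr v 0, b.repr v 1, b.repr v 2, b.repr v 3, ?_⟩
  exact (b.sum_repr v).symm.trans (by rw [Fin.sum_univ_four])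

theorem basis_four_coeff {b : Module.Basis (Fin 4) ℂ L} {p q r s : ℂ}
    (h : p • b 0 + q • b 1 + r • b 2 + s • b 3 = 0) : p = 0 ∧ q = 0 ∧ r = 0 ∧ s = 0 := by
  have h1 := Fintype.linearIndependent_iff.1 b.linearIndependent ![p, q, r, s]
    (by simpa [Fin.sum_univ_succ, add_assoc] using h)
  exact ⟨h1 0, h1 1, h1 2, h1 3⟩

variable {ev : L →ₗ[ℂ] T} {B : T →ₗ[ℂ] T →ₗ[ℂ] ℂ} {b : Module.Basis (Fin 4) ℂ L}

/-- The vectors `ev (b i)` span `T`, so non-degeneracy need only be tested on them. This is how a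
single product is shown to be nonzero when the others vanish. -/
theorem eq_zero_of_orthogonal (hsurj : Function.Surjective ev)
    (hnd : ∀ v, (∀ w, B v w = 0) → v = 0) {u : T} (h0 : B u (ev (b 0)) = 0)
    (h1 : B u (ev (b 1)) = 0) (h2 : B u (ev (b 2)) = 0) (h3 : B u (ev (b 3)) = 0) : u = 0 := by
  refine hnd u fun w ↦ ?_
  obtain ⟨w, rfl⟩ := hsurj w
  obtain ⟨p, q, r, s, rfl⟩ := basis_four_repr b w
  simp [h0, h1, h2, h3]

theorem eq_zero_of_ev_lie_eq_zero {y : L}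
    (hf : (∀ w, ev ⁅y, w⁆ = 0) → y = 0) (h0 : ev ⁅y, b 0⁆ = 0)
    (h1 : ev ⁅y, b 1⁆ = 0) (h2 : ev ⁅y, b 2⁆ = 0) (h3 : ev ⁅y, b 3⁆ = 0) : y = 0 := by
  refine hf fun w ↦ ?_
  obtain ⟨p, q, r, s, rfl⟩ := basis_four_repr b w
  simp [h0, h1, h2, h3]

theorem ev_basis_ne_zero (hker : LinearMap.ker ev = Submodule.span ℂ {b 0}) {i : Fin 4}
    (hi : i ≠ 0) : ev (b i) ≠ 0 := by
  intro h
  have : b i ∈ LinearMap.ker ev := h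
  rw [hker, Submodule.mem_span_singleton] at this
  obtain ⟨c, hc⟩ := this
  simpa [hi.symm] using congrArg (fun v ↦ b.repr v i) hc

/-- If the isotropy is contained in a subalgebra isomorphic to the Lie algebra of `ℂ × AG`, then it
is not contained in the abelian ideal spanned by the centre and the translations. -/
theorem homothety_coeff_ne_zero [LieAlgebra.IsSolvable L] (hsurj : Function.Surjective ev)
    (hsymm : ∀ v w, B v w = B w v) (hnd : ∀ v, (∀ w, B v w = 0) → v = 0)
    (h01 : ⁅b 0, b 1⁆ = 0) (h02 : ⁅b 0, b 2⁆ = b 2) (h12 : ⁅b 1, b 2⁆ = 0) {y : L} (hy : y ≠ 0)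
    (hev : ev y = 0) (hskew : ∀ v w, B (ev ⁅y, v⁆) (ev w) + B (ev v) (ev ⁅y, w⁆) = 0)
    (hf : (∀ w, ev ⁅y, w⁆ = 0) → y = 0) {a β d : ℂ} (hyb : y = a • b 0 + β • b 1 + d • b 2) :
    a ≠ 0 := by
  -- With `a = 0`, `y` lies in the abelian span of `b 1` and `b 2`. The only unknown bracket is `⁅y,
  -- b 3⁆`, whose products with all the `ev (b i)` follow from skewness.
  rintro rfl
  have : FiniteDimensional ℂ L := b.finiteDimensional_of_finite
  have h10 : ⁅b 1, b 0⁆ = 0 := by rw [← lie_skew, h01, neg_zero]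
  have h20 : ⁅b 2, b 0⁆ = -b 2 := by rw [← lie_skew, h02]
  have h21 : ⁅b 2, b 1⁆ = 0 := by rw [← lie_skew, h12, neg_zero]
  have y0 : ⁅y, b 0⁆ = -(d • b 2) := by simp [hyb, h10, h20]
  have y1 : ⁅y, b 1⁆ = 0 := by simp [hyb, h21]
  have y2 : ⁅y, b 2⁆ = 0 := by simp [hyb, h12]
  obtain ⟨α, μ, γ, l, y3⟩ := basis_four_repr b ⁅y, b 3⁆
  have hrel : β • ev (b 1) + d • ev (b 2) = 0 := by simpa [hyb] using hev
  set r := ev (b 0)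
  set p := ev (b 1)
  set q := ev (b 2)
  set w := ev (b 3)
  have e3 : ev ⁅y, b 3⁆ = α • r + μ • p + γ • q + l • w := by simp [y3, r, p, q, w]
  have s33 : B (ev ⁅y, b 3⁆) w = 0 := by
    have := hskew (b 3) (b 3)
    rw [hsymm w] at this
    simpa [w] using this
  have s13 : B (ev ⁅y, b 3⁆) p = 0 := by
    have := hskew (b 1) (b 3)
    rw [y1, hsymm (ev (b 1))] at this
    simpa using this
  have s23 : B (ev ⁅y, b 3⁆) q = 0 := by
    have := hskew (b 2) (b 3)
    rw [y2, hsymm (ev (b 2))] at this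
    simpa using this
  have s03 : B (ev ⁅y, b 3⁆) r = d * B q w := by
    have := hskew (b 0) (b 3)
    rw [y0, hsymm (ev (b 0))] at this
    simp only [map_neg, map_smul, LinearMap.neg_apply, LinearMap.smul_apply, smul_eq_mul] at this
    linear_combination this
  -- If `d • q = 0`, then `ev ⁅y, b 3⁆` is orthogonal to everything and `y` acts trivially on `T`,
  -- against faithfulness.
  have hdq : d • q ≠ 0 := by
    intro hdq
    have h3 : ev ⁅y, b 3⁆ = 0 := by
      refine eq_zero_of_orthogonal (b := b) hsurj hnd ?_ s13 s23 s33
      refine s03.trans ?_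
      rw [← smul_eq_mul, ← LinearMap.smul_apply, ← map_smul, hdq, map_zero, LinearMap.zero_apply]
    refine hy (eq_zero_of_ev_lie_eq_zero (b := b) hf ?_ ?_ ?_ h3)
    · rw [y0, map_neg, map_smul, hdq, neg_zero]
    · rw [y1, map_zero]
    · rw [y2, map_zero]
  have hd : d ≠ 0 := fun h ↦ hdq (by rw [h, zero_smul])
  have hq : q ≠ 0 := fun h ↦ hdq (by rw [h, smul_zero])
  have hβ : β ≠ 0 := fun h ↦ hdq (by rwa [h, zero_smul, zero_add] at hrel)
  have q0 : B q r = 0 := by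
    have := hskew (b 0) (b 0)
    rw [hsymm (ev (b 0)), y0] at this
    simp only [map_neg, map_smul, LinearMap.neg_apply, LinearMap.smul_apply, smul_eq_mul] at this
    refine (mul_eq_zero.1 (?_ : d * B q r = 0)).resolve_left hd
    linear_combination -this / 2
  have q1 : B q p = 0 := by
    have := hskew (b 0) (b 1)
    rw [y0, y1] at this
    simpa [hd] using this
  have q2 : B q q = 0 := by
    have := hskew (b 0) (b 2)
    rw [y0, y2] at this
    simpa [hd] using this
  -- The vector `q` is orthogonal to `r`, `p` and itself, so only `w` can detect it.
  have q3 : B q w ≠ 0 := fun h ↦ hq (eq_zero_of_orthogonal (b := b) hsurj hnd q0 q1 q2 h)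
  have hl : l = 0 := by
    rw [e3, hsymm] at s23
    simpa [q0, q1, q2, q3] using s23
  -- As `l = 0`, the bracket `⁅y, b 3⁆` acts on `b 2` with eigenvalue `α`; here solvability is
  -- essential.
  have hα : α = 0 := by
    refine LieModule.eigenvalue_lie_eq_zero_of_isSolvable y (b 3) _ rfl (b.ne_zero 2) ?_
    rw [y3, hl]
    simp [h02, h12]
  have hp : p = (-(d / β)) • q := by
    have : β • p = β • ((-(d / β)) • q) := by
      rw [smul_smul, eq_neg_of_add_eq_zero_left hrel, ← neg_smul]
      congr 1
      field_simp
    exact smul_right_injective T hβ this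
  -- Now `ev ⁅y, b 3⁆` is a multiple of `q` orthogonal to `w`, hence zero, while its product with
  -- `r` should be `d * B q w ≠ 0`.
  have e3' : ev ⁅y, b 3⁆ = (μ * (-(d / β)) + γ) • q := by
    rw [e3, hl, hα, hp]
    module
  rw [e3', map_smul, LinearMap.smul_apply, smul_eq_mul] at s33 s03
  rw [(mul_eq_zero.1 s33).resolve_right q3, zero_mul] at s03
  exact mul_ne_zero hd q3 s03.symm

/-- If the isotropy is spanned by the generator `b 0` of the homotheties, then the adjoint action of
`b 0` has the eigenvalue `-1`. -/
theorem exists_lie_eq_neg (hsurj : Function.Surjective ev) (hnd : ∀ v, (∀ w, B v w = 0) → v = 0)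
    (h01 : ⁅b 0, b 1⁆ = 0) (h02 : ⁅b 0, b 2⁆ = b 2) (hev0 : ev (b 0) = 0)
    (hskew : ∀ v w, B (ev ⁅b 0, v⁆) (ev w) + B (ev v) (ev ⁅b 0, w⁆) = 0) (hev : ev (b 2) ≠ 0) :
    ∃ b' : Module.Basis (Fin 4) ℂ L, b' 0 = b 0 ∧ b' 1 = b 1 ∧ b' 2 = b 2 ∧
      ⁅b' 0, b' 3⁆ = -b' 3 := by
  obtain ⟨α, μ, γ, l, y3⟩ := basis_four_repr b ⁅b 0, b 3⁆
  have q2 : B (ev (b 2)) (ev (b 2)) = 0 := by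
    have := hskew (b 2) (b 2)
    rw [h02] at this
    linear_combination this / 2
  have q1 : B (ev (b 2)) (ev (b 1)) = 0 := by
    have := hskew (b 2) (b 1)
    rwa [h02, h01, map_zero, map_zero, add_zero] at this
  have q3 : B (ev (b 2)) (ev (b 3)) ≠ 0 := fun h ↦
    hev (eq_zero_of_orthogonal (b := b) hsurj hnd (by rw [hev0, map_zero]) q1 q2 h)
  -- Skewness pairs eigenvalues to sum zero: `b 2` has eigenvalue 1 and `ev (b 2)` is paired
  -- nontrivially only with `ev (b 3)`.
  have hl : l = -1 := by
    have := hskew (b 2) (b 3)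
    rw [h02, y3] at this
    simp only [map_add, map_smul, smul_eq_mul, q1, q2, hev0, map_zero] at this
    refine mul_right_cancel₀ q3 ?_
    linear_combination this
  -- Each component is divided by the difference between its eigenvalue and -1, which is 1 for `b 0`
  -- and `b 1` and 2 for `b 2`.
  let t := b 3 - α • b 0 - μ • b 1 - (γ / 2) • b 2
  have hli : LinearIndependent ℂ ![b 0, b 1, b 2, t] := by
    rw [Fintype.linearIndependent_iff]
    intro c hc
    have h0 : (c 0 - c 3 * α) • b 0 + (c 1 - c 3 * μ) • b 1 + (c 2 - c 3 * (γ / 2)) • b 2 +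
        c 3 • b 3 = 0 := by
      rw [← hc]
      simp only [Fin.sum_univ_four, Matrix.cons_val, t]
      module
    obtain ⟨h0, h1, h2, h3⟩ := basis_four_coeff h0
    rw [h3, zero_mul, sub_zero] at h0 h1 h2
    simp [Fin.forall_fin_succ, h0, h1, h2, h3]
  have hcard : Fintype.card (Fin 4) = Module.finrank ℂ L := (Module.finrank_eq_card_basis b).symm
  refine ⟨basisOfLinearIndependentOfCardEqFinrank hli hcard, ?_, ?_, ?_, ?_⟩ <;>
    simp only [coe_basisOfLinearIndependentOfCardEqFinrank, Matrix.cons_val]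
  simp only [t, lie_sub, lie_smul, lie_self, h01, h02, y3, hl]
  module

/-- The remaining brackets in a basis of eigenvectors of the isotropy. -/
theorem lie_of_weight_basis [LieAlgebra.IsSolvable L]
    (h01 : ⁅b 0, b 1⁆ = 0) (h02 : ⁅b 0, b 2⁆ = b 2) (h03 : ⁅b 0, b 3⁆ = -b 3)
    (h12 : ⁅b 1, b 2⁆ = 0) :
    ∃ δ κ : ℂ, ⁅b 1, b 3⁆ = δ • b 3 ∧ ⁅b 2, b 3⁆ = κ • b 1 ∧ (δ = 0 ∨ κ = 0) := by
  have : FiniteDimensional ℂ L := b.finiteDimensional_of_finite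
  obtain ⟨p₁, p₂, p₃, p₄, hp⟩ := basis_four_repr b ⁅b 1, b 3⁆
  obtain ⟨q₁, q₂, q₃, q₄, hq⟩ := basis_four_repr b ⁅b 2, b 3⁆
  -- The bracket has weight 0 + (-1) for `b 0`, and that weight space is spanned by `b 3`.
  have h13 : ⁅b 1, b 3⁆ = p₄ • b 3 := by
    have h := leibniz_lie (b 0) (b 1) (b 3)
    rw [h01, h03, zero_lie, zero_add, lie_neg, hp] at h
    simp only [lie_add, lie_smul, lie_self, h01, h02, h03] at h
    obtain ⟨e1, e2, e3, -⟩ := basis_four_coeff (b := b) (p := p₁) (q := p₂) (r := 2 * p₃) (s := 0)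
      (by rw [← sub_eq_zero] at h; rw [← h]; module)
    rw [hp, e1, e2, (mul_eq_zero.1 e3).resolve_left two_ne_zero]
    module
  -- The bracket has weight 1 + (-1) = 0.
  have h23 : ⁅b 2, b 3⁆ = q₁ • b 0 + q₂ • b 1 := by
    have h := leibniz_lie (b 0) (b 2) (b 3)
    rw [h02, h03, lie_neg, add_neg_cancel, hq] at h
    simp only [lie_add, lie_smul, lie_self, h01, h02, h03] at h
    obtain ⟨-, -, e3, e4⟩ := basis_four_coeff (b := b) (p := 0) (q := 0) (r := q₃) (s := -q₄)
      (by rw [← h]; module)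
    rw [hq, e3, neg_eq_zero.1 e4]
    module
  -- `q₁` is an eigenvalue of `⁅b 2, b 3⁆` on `b 2`; a nonzero one would produce a copy of sl₂.
  have hq₁ : q₁ = 0 := by
    refine LieModule.eigenvalue_lie_eq_zero_of_isSolvable (b 2) (b 3) _ rfl (b.ne_zero 2) ?_
    simp [h23, h02, h12]
  rw [hq₁, zero_smul, zero_add] at h23
  refine ⟨p₄, q₂, h13, h23, ?_⟩
  -- Jacobi for `b 1`, `b 2`, `b 3` reduces to `δ κ b 1 = 0`.
  have h := leibniz_lie (b 1) (b 2) (b 3)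
  rw [h12, h23, h13, lie_smul, lie_self, smul_zero, zero_lie, zero_add, lie_smul, h23, smul_smul]
    at h
  exact mul_eq_zero.1 ((smul_eq_zero.1 h.symm).resolve_right (b.ne_zero 1))

/-- A four-dimensional transitive solvable algebra whose isotropy lies in a subalgebra isomorphic
to the Lie algebra of `ℂ × AG` has a basis of eigenvectors of the isotropy. -/
theorem exists_adapted_basis [LieAlgebra.IsSolvable L] (hsurj : Function.Surjective ev)
    (hker : Module.finrank ℂ (LinearMap.ker ev) = 1)
    (hsymm : ∀ v w, B v w = B w v) (hnd : ∀ v, (∀ w, B v w = 0) → v = 0)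
    (h01 : ⁅b 0, b 1⁆ = 0) (h02 : ⁅b 0, b 2⁆ = b 2) (h12 : ⁅b 1, b 2⁆ = 0)
    (hskew : ∀ y, ev y = 0 → ∀ v w, B (ev ⁅y, v⁆) (ev w) + B (ev v) (ev ⁅y, w⁆) = 0)
    (hf : ∀ y, ev y = 0 → (∀ w, ev ⁅y, w⁆ = 0) → y = 0) {y : L} (hy : y ≠ 0) (hev : ev y = 0)
    {a β d : ℂ} (hyb : y = a • b 0 + β • b 1 + d • b 2) :
    ∃ b' : Module.Basis (Fin 4) ℂ L, LinearMap.ker ev = Submodule.span ℂ {b' 0} ∧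
      (∃ β' d' : ℂ, b' 0 = b 0 + β' • b 1 + d' • b 2) ∧ b' 1 = b 1 ∧ b' 2 = b 2 ∧
      ⁅b' 0, b' 1⁆ = 0 ∧ ⁅b' 0, b' 2⁆ = b' 2 ∧ ⁅b' 0, b' 3⁆ = -b' 3 ∧ ⁅b' 1, b' 2⁆ = 0 := by
  have ha := homothety_coeff_ne_zero hsurj hsymm hnd h01 h02 h12 hy hev (hskew y hev) (hf y hev) hyb
  -- This is `a⁻¹ • y`. Since `b 1` and `b 2` commute, its brackets with them are those of `b 0`.
  let h := b 0 + (a⁻¹ * β) • b 1 + (a⁻¹ * d) • b 2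
  have hh : h = a⁻¹ • y := by
    simp only [h, hyb, smul_add, smul_smul, inv_mul_cancel₀ ha, one_smul]
  have hli : LinearIndependent ℂ ![h, b 1, b 2, b 3] := by
    rw [Fintype.linearIndependent_iff]
    intro c hc
    have h0 : c 0 • b 0 + (c 0 * (a⁻¹ * β) + c 1) • b 1 + (c 0 * (a⁻¹ * d) + c 2) • b 2 +
        c 3 • b 3 = 0 := by
      rw [← hc]
      simp only [Fin.sum_univ_four, Matrix.cons_val, h]
      module
    obtain ⟨h0, h1, h2, h3⟩ := basis_four_coeff h0
    rw [h0, zero_mul, zero_add] at h1 h2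
    simp [Fin.forall_fin_succ, h0, h1, h2, h3]
  have hcard : Fintype.card (Fin 4) = Module.finrank ℂ L := (Module.finrank_eq_card_basis b).symm
  let b₁ := basisOfLinearIndependentOfCardEqFinrank hli hcard
  have e0 : b₁ 0 = h := by simp [b₁]
  have e1 : b₁ 1 = b 1 := by simp [b₁]
  have e2 : b₁ 2 = b 2 := by simp [b₁]
  have hev0 : ev (b₁ 0) = 0 := by rw [e0, hh, map_smul, hev, smul_zero]
  have h21 : ⁅b 2, b 1⁆ = 0 := by rw [← lie_skew, h12, neg_zero]
  have hker' : LinearMap.ker ev = Submodule.span ℂ {b₁ 0} := by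
    have : FiniteDimensional ℂ L := b.finiteDimensional_of_finite
    refine (Submodule.eq_of_le_of_finrank_eq ?_ ?_).symm
    · rw [Submodule.span_singleton_le_iff_mem]
      exact hev0
    · rw [finrank_span_singleton (b₁.ne_zero 0), hker]
  have hev2 : ev (b₁ 2) ≠ 0 := ev_basis_ne_zero hker' (by decide)
  have k01 : ⁅b₁ 0, b₁ 1⁆ = 0 := by simp [e0, e1, h, h01, h21]
  have k02 : ⁅b₁ 0, b₁ 2⁆ = b₁ 2 := by simp [e0, e2, h, h02, h12]
  obtain ⟨b', f0, f1, f2, f3⟩ := exists_lie_eq_neg hsurj hnd k01 k02 hev0 (hskew _ hev0) hev2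
  refine ⟨b', by rw [f0, hker'], ⟨_, _, f0.trans e0⟩, f1.trans e1, f2.trans e2, ?_, ?_, f3, ?_⟩
  · rw [f0, f1, k01]
  · rw [f0, f2, k02]
  · rw [f1, f2, e1, e2, h12]

/-- The eigenvectors of the isotropy can be normalized. -/
theorem exists_normalized_basis (hT : Module.finrank ℂ T = 3) (hsurj : Function.Surjective ev)
    (hsymm : ∀ v w, B v w = B w v) (hnd : ∀ v, (∀ w, B v w = 0) → v = 0)
    (h01 : ⁅b 0, b 1⁆ = 0) (h02 : ⁅b 0, b 2⁆ = b 2) (h03 : ⁅b 0, b 3⁆ = -b 3)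
    (hker : LinearMap.ker ev = Submodule.span ℂ {b 0})
    (hskew : ∀ v w, B (ev ⁅b 0, v⁆) (ev w) + B (ev v) (ev ⁅b 0, w⁆) = 0) :
    ∃ (e : Module.Basis (Fin 3) ℂ T) (s r : ℂ), e 0 = s • ev (b 1) ∧ e 1 = ev (b 2) ∧
      e 2 = r • ev (b 3) ∧ B (e 0) (e 0) = 1 ∧ B (e 0) (e 1) = 0 ∧ B (e 0) (e 2) = 0 ∧
      B (e 1) (e 1) = 0 ∧ B (e 2) (e 2) = 0 ∧ B (e 1) (e 2) = 1 := by
  have hne : ∀ i, i ≠ 0 → ev (b i) ≠ 0 := fun i ↦ ev_basis_ne_zero hker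
  have hev0 : ev (b 0) = 0 := by
    rw [← LinearMap.mem_ker, hker]
    exact Submodule.mem_span_singleton_self _
  have pq : B (ev (b 1)) (ev (b 2)) = 0 := by
    simpa [h01, h02] using hskew (b 1) (b 2)
  have pw : B (ev (b 1)) (ev (b 3)) = 0 := by
    simpa [h01, h03] using hskew (b 1) (b 3)
  have qq : B (ev (b 2)) (ev (b 2)) = 0 := by
    have := hskew (b 2) (b 2)
    rw [h02] at this
    linear_combination this / 2
  have ww : B (ev (b 3)) (ev (b 3)) = 0 := by
    have := hskew (b 3) (b 3)
    rw [h03, map_neg, map_neg, map_neg, LinearMap.neg_apply] at this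
    linear_combination -this / 2
  have pp : B (ev (b 1)) (ev (b 1)) ≠ 0 := fun h ↦ hne 1 (by decide)
    (eq_zero_of_orthogonal (b := b) hsurj hnd (by rw [hev0, map_zero]) h pq pw)
  have qw : B (ev (b 2)) (ev (b 3)) ≠ 0 := fun h ↦ hne 2 (by decide)
    (eq_zero_of_orthogonal (b := b) hsurj hnd (by rw [hev0, map_zero]) ((hsymm _ _).trans pq) qq h)
  -- A complex square root of the squared norm normalizes the weight 0 vector. Of the two isotropic
  -- vectors only the last is rescaled, to make their product 1.
  obtain ⟨σ, hσ⟩ := IsAlgClosed.exists_eq_mul_self (B (ev (b 1)) (ev (b 1)))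
  have hσ0 : σ ≠ 0 := by
    rintro rfl
    exact pp (by rw [hσ, zero_mul])
  let u : Fin 3 → T := ![σ⁻¹ • ev (b 1), ev (b 2), (B (ev (b 2)) (ev (b 3)))⁻¹ • ev (b 3)]
  have u00 : B (u 0) (u 0) = 1 := by
    simp only [u, Matrix.cons_val, map_smul, LinearMap.smul_apply, smul_eq_mul, hσ]
    field_simp
  have u01 : B (u 0) (u 1) = 0 := by simp [u, pq]
  have u02 : B (u 0) (u 2) = 0 := by simp [u, pw]
  have u11 : B (u 1) (u 1) = 0 := qq
  have u22 : B (u 2) (u 2) = 0 := by simp [u, ww]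
  have u12 : B (u 1) (u 2) = 1 := by simp [u, qw]
  -- The Gram matrix is invertible: pairing a relation with `u 0`, `u 1`, `u 2` isolates the
  -- coefficients of `u 0`, `u 2`, `u 1`.
  have hli : LinearIndependent ℂ u := by
    rw [Fintype.linearIndependent_iff]
    intro c hc
    have h (i : Fin 3) : B (u i) (∑ j, c j • u j) = 0 := by rw [hc, map_zero]
    simp only [Fin.sum_univ_three, map_add, map_smul, smul_eq_mul] at h
    have h0 := h 0
    have h1 := h 1
    have h2 := h 2
    rw [u00, u01, u02] at h0
    rw [hsymm (u 1) (u 0), u01, u11, u12] at h1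
    rw [hsymm (u 2) (u 0), hsymm (u 2) (u 1), u02, u12, u22] at h2
    simp only [mul_zero, mul_one, zero_add, add_zero] at h0 h1 h2
    simp [Fin.forall_fin_succ, h0, h1, h2]
  have hcard : Fintype.card (Fin 3) = Module.finrank ℂ T := by rw [hT, Fintype.card_fin]
  refine ⟨basisOfLinearIndependentOfCardEqFinrank hli hcard, σ⁻¹, (B (ev (b 2)) (ev (b 3)))⁻¹, ?_⟩
  rw [coe_basisOfLinearIndependentOfCardEqFinrank]
  exact ⟨rfl, rfl, rfl, u00, u01, u02, u11, u22, u12⟩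

end Algebra

/-! ### Bases of the subalgebras of germs -/

theorem span_range_eq_of_finrank_eq {V : Type*} [AddCommGroup V] [Module ℂ V] {n : ℕ}
    {u : Fin n → V} (hu : LinearIndependent ℂ u) {S : Submodule ℂ V} (hS : ∀ i, u i ∈ S)
    [FiniteDimensional ℂ S] (hn : Module.finrank ℂ S = n) :
    Submodule.span ℂ (Set.range u) = S := by
  refine Submodule.eq_of_le_of_finrank_eq (Submodule.span_le.2 ?_) ?_
  · rintro _ ⟨i, rfl⟩
    exact hS i
  · rw [finrank_span_eq_card hu, Fintype.card_fin, hn]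

/-- Rescaling `x` is the freedom that normalizes the structure constants of the last two model
groups. -/
theorem linearIndependent_smul_snd {V : Type*} [AddCommGroup V] [Module ℂ V] {y x z t : V}
    (h : LinearIndependent ℂ ![y, x, z, t]) {c : ℂ} (hc : c ≠ 0) :
    LinearIndependent ℂ ![y, c • x, z, t] := by
  convert h.units_smul ![1, Units.mk0 c hc, 1, 1] using 1
  ext i
  fin_cases i <;> simp [Units.smul_def]

/-- A Lie algebra of the group `ℂ × AG` has a basis of a homothety, a central element and a
translation. -/
theorem CAG.exists_basis_of_isGroupOf {L : Type*} [LieRing L] [LieAlgebra ℂ L]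
    {φ : GroupLieAlgebra 𝓘(ℂ, EuclideanSpace ℂ (Fin 3)) CAG →ₗ⁅ℂ⁆ L} {S : Submodule ℂ L}
    (h : IsGroupOf (EuclideanSpace ℂ (Fin 3)) φ S) :
    ∃ u : Module.Basis (Fin 3) ℂ S, ⁅(u 0 : L), (u 1 : L)⁆ = 0 ∧ ⁅(u 0 : L), (u 2 : L)⁆ = u 2 ∧
      ⁅(u 1 : L), (u 2 : L)⁆ = 0 := by
  obtain ⟨-, hinj, hrange⟩ := h
  let φ' : GroupLieAlgebra 𝓘(ℂ, EuclideanSpace ℂ (Fin 3)) CAG →ₗ[ℂ] L := φ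
  let ψ : EuclideanSpace ℂ (Fin 3) →ₗ[ℂ] L := φ'
  have hrange : LinearMap.range ψ = S := hrange
  let β : EuclideanSpace ℂ (Fin 3) → EuclideanSpace ℂ (Fin 3) → EuclideanSpace ℂ (Fin 3) :=
    fun v w ↦ !₂[0, 0, v 0 * w 2 - w 0 * v 2]
  have hψ : ∀ v w : EuclideanSpace ℂ (Fin 3), ⁅ψ v, ψ w⁆ = ψ (β v w) := fun v w ↦
    (φ.map_lie v w).symm.trans (congrArg φ (CAG.bracket v w))
  let u := ((EuclideanSpace.basisFun (Fin 3) ℂ).toBasis.map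
    (LinearEquiv.ofInjective ψ hinj)).map (LinearEquiv.ofEq _ _ hrange)
  have hu (i : Fin 3) : (u i : L) = ψ (EuclideanSpace.single i 1) := by
    simp only [u, Module.Basis.map_apply, OrthonormalBasis.coe_toBasis,
      EuclideanSpace.basisFun_apply]
    rfl
  have hβ (i j : Fin 3) (v : EuclideanSpace ℂ (Fin 3))
      (h : β (EuclideanSpace.single i 1) (EuclideanSpace.single j 1) = v) :
      ⁅(u i : L), (u j : L)⁆ = ψ v := by
    rw [hu, hu, hψ, h]
  refine ⟨u, ?_, ?_, ?_⟩
  · rw [hβ 0 1 0 (by ext i; fin_cases i <;> simp [β]), map_zero]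
  · exact (hβ 0 2 (EuclideanSpace.single 2 1)
      (by ext i; fin_cases i <;> simp [β])).trans (hu 2).symm
  · rw [hβ 1 2 0 (by ext i; fin_cases i <;> simp [β]), map_zero]

end HolRiem

end

/-! ### The classification -/

theorem mainTheorem8 {M : Type*} [TopologicalSpace M] [ChartedSpace (EuclideanSpace ℂ (Fin 3)) M]
    [IsManifold 𝓘(ℂ, EuclideanSpace ℂ (Fin 3)) ω M]
    (g : HolRiem.HolRiemannianMetric (EuclideanSpace ℂ (Fin 3)) M) (x₀ : M)
    (𝒢 : LieSubalgebra ℂ (HolRiem.HolGerm (EuclideanSpace ℂ (Fin 3)) x₀))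
    (hKilling : 𝒢 ≤ HolRiem.killingAlgebra g x₀)
    (htrans : HolRiem.IsTransitive 𝒢)
    (hdim : Module.finrank ℂ 𝒢 = 4)
    (hsolv : LieAlgebra.IsSolvable 𝒢)
    (f : M → ℂ) (hf : HolRiem.DefinesFoliation g 𝒢 f)
    (hH : ∃ φ : GroupLieAlgebra 𝓘(ℂ, EuclideanSpace ℂ (Fin 3)) HolRiem.CAG →ₗ⁅ℂ⁆
        HolRiem.HolGerm (EuclideanSpace ℂ (Fin 3)) x₀,
      HolRiem.IsGroupOf (EuclideanSpace ℂ (Fin 3)) φ (HolRiem.leafStabilizer 𝒢 f)) :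
    HolRiem.IsSemisimpleIsotropy g 𝒢 ∧
    HolRiem.IsPairOf (EuclideanSpace ℂ (Fin 3)) HolRiem.CAG.oneParam
      (HolRiem.leafStabilizer 𝒢 f) (HolRiem.isotropy 𝒢) ∧
    (HolRiem.IsPairOf (EuclideanSpace ℂ (Fin 4)) HolRiem.CSol.oneParam
        𝒢.toSubmodule (HolRiem.isotropy 𝒢) ∨
      HolRiem.IsPairOf (EuclideanSpace ℂ (Fin 4)) HolRiem.CHeis.oneParam
        𝒢.toSubmodule (HolRiem.isotropy 𝒢) ∨
      HolRiem.IsPairOf (EuclideanSpace ℂ (Fin 4)) HolRiem.C2C2.oneParam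
        𝒢.toSubmodule (HolRiem.isotropy 𝒢)) := by

  have : FiniteDimensional ℂ 𝒢 := Module.finite_of_finrank_pos (by omega)
  have hHle : HolRiem.leafStabilizer 𝒢 f ≤ 𝒢.toSubmodule := fun v hv ↦ hv.1
  have hT : Module.finrank ℂ (TangentSpace 𝓘(ℂ, EuclideanSpace ℂ (Fin 3)) x₀) = 3 :=
    finrank_euclideanSpace_fin (𝕜 := ℂ) (n := 3)
  have : FiniteDimensional ℂ (TangentSpace 𝓘(ℂ, EuclideanSpace ℂ (Fin 3)) x₀) :=
    Module.finite_of_finrank_pos (by omega)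
  obtain ⟨φ, hφ⟩ := hH
  obtain ⟨u, u01, u02, u12⟩ := HolRiem.CAG.exists_basis_of_isGroupOf hφ
  have : FiniteDimensional ℂ (HolRiem.leafStabilizer 𝒢 f) := u.finiteDimensional_of_finite
  let ev : 𝒢 →ₗ[ℂ] TangentSpace 𝓘(ℂ, EuclideanSpace ℂ (Fin 3)) x₀ :=
    HolRiem.ev x₀ ∘ₗ 𝒢.toSubmodule.subtype
  let B : TangentSpace 𝓘(ℂ, EuclideanSpace ℂ (Fin 3)) x₀ →ₗ[ℂ]
      TangentSpace 𝓘(ℂ, EuclideanSpace ℂ (Fin 3)) x₀ →ₗ[ℂ] ℂ :=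
    ContinuousLinearMap.coeLM ℂ ∘ₗ (g.form x₀).toLinearMap
  let df : TangentSpace 𝓘(ℂ, EuclideanSpace ℂ (Fin 3)) x₀ →ₗ[ℂ] ℂ :=
    (mvfderiv 𝓘(ℂ, EuclideanSpace ℂ (Fin 3)) f x₀).toLinearMap
  have hdf : df ≠ 0 := fun h ↦ hf.submersion (ContinuousLinearMap.coe_injective h)
  have hsurj : Function.Surjective ev := fun t ↦ by
    obtain ⟨v, hv, h⟩ := htrans t
    exact ⟨⟨v, hv⟩, h⟩
  have hker : Module.finrank ℂ (LinearMap.ker ev) = 1 := by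
    have := LinearMap.finrank_range_add_finrank_ker ev
    rw [LinearMap.range_eq_top.2 hsurj, finrank_top, hT, hdim] at this
    omega
  have hleaf : ∀ v ∈ HolRiem.leafStabilizer 𝒢 f, df (HolRiem.ev x₀ v) = 0 := by
    rintro _ ⟨-, V, rfl, hV⟩
    exact hV.self_of_nhds rfl
  -- If a nonzero isotropy element `y` acted trivially, every `⁅w, y⁆` with `w` in `𝒢` would vanish
  -- at `x₀`. It would then lie in the isotropy, the line of `y`, and the rigidity of such germs
  -- gives `y = 0`.
  have hfaith : ∀ y, ev y = 0 → (∀ w, ev ⁅y, w⁆ = 0) → y = 0 := by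
    intro y hy hw
    by_contra hy0
    have hspan : LinearMap.ker ev = Submodule.span ℂ {y} := by
      refine (Submodule.eq_of_le_of_finrank_eq ?_ ?_).symm
      · rw [Submodule.span_singleton_le_iff_mem]
        exact hy
      · rw [finrank_span_singleton hy0, hker]
    refine hy0 (Subtype.ext (HolRiem.eq_zero_of_lie_eq_smul hy fun t ↦ ?_))
    obtain ⟨w, rfl⟩ := hsurj t
    refine ⟨w, rfl, ?_⟩
    have h1 : ⁅w, y⁆ ∈ LinearMap.ker ev := by
      rw [LinearMap.mem_ker, ← lie_skew, map_neg, hw, neg_zero]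
    rw [hspan, Submodule.mem_span_singleton] at h1
    obtain ⟨c, hc⟩ := h1
    exact ⟨c, (congrArg Subtype.val hc).symm⟩
  have hskew : ∀ y, ev y = 0 → ∀ v w, B (ev ⁅y, v⁆) (ev w) + B (ev v) (ev ⁅y, w⁆) = 0 :=
    fun y hy v w ↦ HolRiem.killingAlgebra_form_skew g (hKilling y.2) hy v w
  have hsymm : ∀ v w, B v w = B w v := g.symm x₀
  have hnd : ∀ v, (∀ w, B v w = 0) → v = 0 := g.nondegenerate x₀
  -- A field transverse to the leaf; it completes a basis of the leaf stabilizer to one of `𝒢`.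
  obtain ⟨W, hW⟩ : ∃ W : 𝒢, df (ev W) ≠ 0 := by
    by_contra! h
    refine hdf (LinearMap.ext fun t ↦ ?_)
    obtain ⟨w, rfl⟩ := hsurj t
    exact h w
  let ι : HolRiem.leafStabilizer 𝒢 f →ₗ[ℂ] 𝒢 := Submodule.inclusion hHle
  have hι : ∀ v, df (ev (ι v)) = 0 := fun v ↦ hleaf v v.2
  -- The stabilizer has dimension 3 and evaluates into the plane `ker df`, so some nonzero element
  -- of it vanishes at `x₀`.
  obtain ⟨v, hv0, hv⟩ : ∃ v : HolRiem.leafStabilizer 𝒢 f, v ≠ 0 ∧ ev (ι v) = 0 := by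
    let m : HolRiem.leafStabilizer 𝒢 f →ₗ[ℂ] LinearMap.ker df :=
      LinearMap.codRestrict _ (ev ∘ₗ ι) hι
    have h2 : Module.finrank ℂ (LinearMap.ker df) = 2 := by
      have := Module.Dual.finrank_ker_add_one_of_ne_zero (f := df) hdf
      rw [hT] at this
      omega
    have h3 : LinearMap.ker m ≠ ⊥ := LinearMap.ker_ne_bot_of_finrank_lt (by
      rw [h2, Module.finrank_eq_card_basis u]
      decide)
    obtain ⟨v, hv, hv0⟩ := Submodule.exists_mem_ne_zero_of_ne_bot h3
    exact ⟨v, hv0, congrArg Subtype.val hv⟩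
  have hli : LinearIndependent ℂ ![ι (u 0), ι (u 1), ι (u 2), W] := by
    rw [Fintype.linearIndependent_iff]
    intro c hc
    simp only [Fin.sum_univ_four, Matrix.cons_val] at hc
    have h3 : c 3 = 0 := by
      have := congrArg (fun x ↦ df (ev x)) hc
      simpa [hι, hW] using this
    have h4 : ∑ i, c i.castSucc • u i = 0 := by
      apply Submodule.inclusion_injective hHle
      change ι _ = ι 0
      rw [h3, zero_smul, add_zero] at hc
      rw [Fin.sum_univ_three, map_add ι, map_add ι, map_smul ι, map_smul ι, map_smul ι, map_zero ι]
      exact hc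
    have h5 := Fintype.linearIndependent_iff.1 u.linearIndependent _ h4
    intro i
    exact Fin.lastCases h3 h5 i
  have hcard : Fintype.card (Fin 4) = Module.finrank ℂ 𝒢 := by rw [hdim, Fintype.card_fin]
  let b := basisOfLinearIndependentOfCardEqFinrank hli hcard
  have hb0 : b 0 = ι (u 0) := by simp [b]
  have hb1 : b 1 = ι (u 1) := by simp [b]
  have hb2 : b 2 = ι (u 2) := by simp [b]
  obtain ⟨b', hker', ⟨β', d', h0⟩, h1, h2, h01, h02, h03, h12⟩ :=
    HolRiem.exists_adapted_basis (b := b) (B := B) hsurj hker hsymm hnd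
      (by rw [hb0, hb1]; exact Subtype.ext u01) (by rw [hb0, hb2]; exact Subtype.ext u02)
      (by rw [hb1, hb2]; exact Subtype.ext u12) hskew hfaith (y := ι v)
      (fun h ↦ hv0 (Submodule.inclusion_injective hHle (h.trans (map_zero ι).symm))) hv
      (a := u.repr v 0) (β := u.repr v 1) (d := u.repr v 2) (by
        have := congrArg ι (u.sum_repr v)
        rw [Fin.sum_univ_three, map_add ι, map_add ι, map_smul ι, map_smul ι, map_smul ι] at this
        rw [hb0, hb1, hb2]
        exact this.symm)
  obtain ⟨δ, κ, h13, h23, hδκ⟩ := HolRiem.lie_of_weight_basis h01 h02 h03 h12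
  have hiso : HolRiem.isotropy 𝒢 = Submodule.span ℂ {(b' 0).1} := by
    have : HolRiem.isotropy 𝒢 = (LinearMap.ker ev).map 𝒢.toSubmodule.subtype := by
      rw [LinearMap.ker_comp, Submodule.map_comap_subtype]
      rfl
    rw [this, hker', Submodule.map_span, Set.image_singleton]
    rfl
  have hli4 : LinearIndependent ℂ ![(b' 0).1, (b' 1).1, (b' 2).1, (b' 3).1] := by
    have h : ![(b' 0).1, (b' 1).1, (b' 2).1, (b' 3).1] = 𝒢.toSubmodule.subtype ∘ b' := by
      funext i
      fin_cases i <;> rfl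
    rw [h]
    exact b'.linearIndependent.map' 𝒢.toSubmodule.subtype (Submodule.ker_subtype _)
  have hli3 : LinearIndependent ℂ ![(b' 0).1, (b' 1).1, (b' 2).1] := by
    convert hli4.comp Fin.castSucc (Fin.castSucc_injective 3) using 1
    ext i
    fin_cases i <;> rfl
  have hev0 : ev (b' 0) = 0 := by
    rw [← LinearMap.mem_ker, hker']
    exact Submodule.mem_span_singleton_self _
  have k01 : ⁅(b' 0).1, (b' 1).1⁆ = 0 := congrArg Subtype.val h01
  have k02 : ⁅(b' 0).1, (b' 2).1⁆ = (b' 2).1 := congrArg Subtype.val h02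
  have k03 : ⁅(b' 0).1, (b' 3).1⁆ = -(b' 3).1 := congrArg Subtype.val h03
  have k12 : ⁅(b' 1).1, (b' 2).1⁆ = 0 := congrArg Subtype.val h12
  have k13 : ⁅(b' 1).1, (b' 3).1⁆ = δ • (b' 3).1 := congrArg Subtype.val h13
  have k23 : ⁅(b' 2).1, (b' 3).1⁆ = κ • (b' 1).1 := congrArg Subtype.val h23
  have hdim' : Module.finrank ℂ 𝒢.toSubmodule = 4 := hdim
  refine ⟨?_, ?_, ?_⟩
  · obtain ⟨A, hA⟩ := HolRiem.exists_isIsotropyAction (v := (b' 0).1)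
      (fun t ↦ (htrans t).imp fun _ h ↦ h.2) hev0
    obtain ⟨e, s, r, e0, e1, e2, e00, e01, e02, e11, e22, e12⟩ :=
      HolRiem.exists_normalized_basis hT hsurj hsymm hnd h01 h02 h03 hker' (hskew _ hev0)
    have hA' : ∀ w : 𝒢, A (ev w) = ev ⁅b' 0, w⁆ := fun w ↦ (hA w.1).symm
    refine ⟨b' 0, A, e, hiso, hA, ?_, ?_, ?_, e00, e01, e02, e11, e22, e12⟩
    · rw [e0, map_smul, hA', h01, map_zero, smul_zero]
    · rw [e1, hA', h02]
    · rw [e2, map_smul, hA', h03, map_neg, smul_neg]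
  -- The new generator differs from the homothety `u 0` by elements of the stabilizer, so the first
  -- three vectors of `b'` are a basis of the stabilizer with the relations of ℂ × AG.
  · have hmem0 : (b' 0).1 ∈ HolRiem.leafStabilizer 𝒢 f := by
      rw [h0, hb0, hb1, hb2]
      exact add_mem (add_mem (u 0).2 (Submodule.smul_mem _ _ (u 1).2))
        (Submodule.smul_mem _ _ (u 2).2)
    have hmem : ∀ i, ![(b' 0).1, (b' 1).1, (b' 2).1] i ∈ HolRiem.leafStabilizer 𝒢 f := by
      intro i
      fin_cases i
      · exact hmem0
      · exact (congrArg Subtype.val (h1.trans hb1)) ▸ (u 1).2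
      · exact (congrArg Subtype.val (h2.trans hb2)) ▸ (u 2).2
    rw [hiso, ← HolRiem.span_range_eq_of_finrank_eq hli3 hmem (by
      rw [Module.finrank_eq_card_basis u, Fintype.card_fin])]
    exact HolRiem.CAG.isPairOf hli3 k01 k02 k12
  · have hspan : ∀ c : ℂ, c ≠ 0 → Submodule.span ℂ
        (Set.range ![(b' 0).1, c • (b' 1).1, (b' 2).1, (b' 3).1]) = 𝒢.toSubmodule := by
      intro c hc
      refine HolRiem.span_range_eq_of_finrank_eq (HolRiem.linearIndependent_smul_snd hli4 hc)
        (fun i ↦ ?_) hdim'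
      fin_cases i
      · exact (b' 0).2
      · exact 𝒢.smul_mem c (b' 1).2
      · exact (b' 2).2
      · exact (b' 3).2
    have hy1 : ∀ c : ℂ, ⁅(b' 0).1, c • (b' 1).1⁆ = 0 := fun c ↦ by rw [lie_smul, k01, smul_zero]
    have hx2 : ∀ c : ℂ, ⁅c • (b' 1).1, (b' 2).1⁆ = 0 := fun c ↦ by rw [smul_lie, k12, smul_zero]
    rw [hiso]
    by_cases hδ : δ = 0
    · have hx3 : ∀ c : ℂ, ⁅c • (b' 1).1, (b' 3).1⁆ = 0 := fun c ↦ by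
        rw [smul_lie, k13, hδ, zero_smul, smul_zero]
      by_cases hκ : κ = 0
      · left
        rw [← hspan 1 one_ne_zero]
        exact HolRiem.CSol.isPairOf (HolRiem.linearIndependent_smul_snd hli4 one_ne_zero) (hy1 1)
          k02 k03 (hx2 1) (hx3 1) (by rw [k23, hκ, zero_smul])
      · right; left
        -- With `x = -κ • b' 1`, the relation `⁅b' 2, b' 3⁆ = κ • b' 1` becomes the Heisenberg one,
        -- `⁅z, t⁆ = -x`.
        rw [← hspan (-κ) (neg_ne_zero.2 hκ)]
        exact HolRiem.CHeis.isPairOf (HolRiem.linearIndependent_smul_snd hli4 (neg_ne_zero.2 hκ))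
          (hy1 _) k02 k03 (hx2 _) (hx3 _) (by rw [k23, neg_smul, neg_neg])
    · right; right
      -- The factor `-δ⁻¹` turns `⁅b' 1, b' 3⁆ = δ • b' 3` into `⁅x, t⁆ = -t`; `δ ≠ 0` also forces
      -- `κ = 0`.
      have hδ' : -δ⁻¹ ≠ 0 := neg_ne_zero.2 (inv_ne_zero hδ)
      rw [← hspan _ hδ']
      exact HolRiem.C2C2.isPairOf (HolRiem.linearIndependent_smul_snd hli4 hδ')
        (hy1 _) k02 k03 (hx2 _)
        (by rw [smul_lie, k13, smul_smul, neg_mul, inv_mul_cancel₀ hδ, neg_smul, one_smul])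
        (by rw [k23, hδκ.resolve_left hδ, zero_smul])
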